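/- For a prime power $q$ and integers $0\le r\le n$ put $$\genfrac{[}{]}{0pt}{}{n}{r}_q=\frac{(q^n-1)(q^{n-1}-1)\cdots(q^{n-r+1}-1)}{(q^r-1)(q^{r-1}-1)\cdots(q-1)}.$$ An $(r,M,d;k)_q$ constant-dimension subspace code is a set $\mathcal C$ of $M$ subspaces, each of dimension $k$, of an $r$-dimensional vector space $V$ over $\mathrm{GF}(q)$, whose minimum subspace distance is $$\min\{\dim(U+U')-\dim(U\cap U') : U,U'\in\mathcal C,\ U\neq U'\}=d .$$ **Theorem.** Let $n\ge 4$ be even and let $q$ be a prime power. Then there exists, in every $2n$-dimensional vector space over $\mathrm{GF}(q)$, a $(2n,M,4;n)_q$ constant-dimension subspace code, where $$ M = q^{n^2-n} - 2 (q+1) q^{\frac{n(n-1)}{2}} + \sum_{r=2}^{n-2} \genfrac{[}{]}{0pt}{}{n}{r}_q \sum_{j=2}^{r} (-1)^{r-j} \genfrac{[}{]}{0pt}{}{r}{j}_q q^{\binom{r-j}{2}}\left(q^{n(j-1)}-1\right) $$ $$ + (q+1) \left( \prod_{i=1}^{n-1} (q^i+1) + q^{\frac{n(n-2)}{4}} \prod_{i=0}^{\frac{n-2}{2}}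 (q^{2i+1}-1) \right) - q \sum_{r=1}^{\frac{n-2}{2}} \genfrac{[}{]}{0pt}{}{\frac{n}{2}}{r}_{q^2} + \genfrac{[}{]}{0pt}{}{\frac{n}{2}}{1}_{q^2} \left( \genfrac{[}{]}{0pt}{}{\frac{n}{2}}{1}_{q^2} - 1 \right) + 1 . $$ -/

import Mathlib

open Module

/-- The Gaussian binomial coefficient
`[n r]_q = (q^n - 1) ⋯ (q^(n-r+1) - 1) / ((q^r - 1) ⋯ (q - 1))`, as a rational number
(used only for `r ≤ n` and `2 ≤ q`, where no factor of the denominator is zero). -/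
def gaussBinom (n r q : ℕ) : ℚ :=
  (∏ i ∈ Finset.range r, ((q : ℚ) ^ (n - i) - 1)) /
    ∏ i ∈ Finset.range r, ((q : ℚ) ^ (i + 1) - 1)

/-- The subspace distance `d_s(U, W) = dim (U + W) - dim (U ∩ W)`. In a finite-dimensional space
the natural-number subtraction does not truncate, because `U ∩ W ≤ U + W`. -/
noncomputable def subspaceDist {F V : Type*} [Field F] [AddCommGroup V] [Module F V]
    (U W : Submodule F V) : ℕ :=
  finrank F ↥(U ⊔ W) - finrank F ↥(U ⊓ W)

/-- `C` is an `(r, M, d; k)_q` constant-dimension subspace code in the vector space `V` over the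
field `F` with `q` elements: `V` has dimension `r`, `C` consists of `M` subspaces of dimension `k`,
and the minimum of the subspace distances between distinct members of `C` exists and equals `d`. -/
structure IsConstantDimensionCode {F V : Type*} [Field F] [AddCommGroup V] [Module F V]
    (r M d k q : ℕ) (C : Finset (Submodule F V)) : Prop where
  card_field : Nat.card F = q
  finrank_space : finrank F V = r
  card_eq : C.card = M
  finrank_eq : ∀ U ∈ C, finrank F ↥U = k
  minDist : IsLeast {δ : ℕ | ∃ U ∈ C, ∃ W ∈ C, U ≠ W ∧ δ = subspaceDist U W} d

/-!
Write `n = 2 m`, fix a quadratic extension `K` of `F` and put `S = K ^ m`, a space of dimension `n`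
over `F`. Inside `S × S`, two `n`-dimensional subspaces have distance at least four when they
intersect in codimension at least two. A code of minimum distance four stays one when members
outside some pair at distance four are removed, so it is enough to find at least as many subspaces
as the formula demands (`exists_isConstantDimensionCode_of_le_card`), provided the formula yields
an integer, which is at least two.

The code has three parts (`IsBalancedCode.exists_extension`).

* The graphs of the `q ^ (n ^ 2 - n)` codewords of a linear maximum rank distance code of minimum
  rank distance two. They avoid the second factor.
* The graphs, with the factors exchanged, of the codewords of rank at most `n - 2`. They avoid the
  first factor and meet the second one in dimension at least two. The code contains
  `q ^ (n * (dim X - 1))` maps with range inside a given nonzero subspace `X`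
  (`exists_isMRDCode`), and Möbius inversion over the lattice of subspaces turns this into the
  double sum of the formula, with the zero map as the final `1`
  (`IsMRDCode.natCard_finrank_range_le`).
* A balanced code: subspaces that meet both factors in dimension at least two, with pairwise
  intersections of codimension at least two.

A subspace that meets a factor in dimension at least two and one that avoids it have distance at
least four, so the parts do not interfere. The balanced code has to supply what remains of the
formula (`balancedCount`). For `n = 4` exactly this number of members is obtained from the pairs
`W × λ W` with `W` not a `K`-line and `λ` in `Kˣ / Fˣ`, along with the pairs of `K`-lines
(`exists_isBalancedCode_of_quadratic_extension`). For `n ≥ 6` the spread of `K`-lines, the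
annihilators of its members and a second maximum rank distance code, on a space of dimension
`n - 2`, give a larger family (`exists_isBalancedCode_of_partialSpread`), and the comparison is an
inequality between polynomials in `q`: explicit for `n = 6`, and a matter of comparing orders of
magnitude for `n ≥ 8` (`balancedCount_six_le`, `balancedCount_le`).
-/

/-! ### Gaussian binomial coefficients -/

lemma natCast_pow_sub_one_ne_zero {q : ℕ} (hq : 2 ≤ q) {i : ℕ} (hi : i ≠ 0) :
    (q : ℚ) ^ i - 1 ≠ 0 := by
  have : (1 : ℚ) < (q : ℚ) ^ i := one_lt_pow₀ (by exact_mod_cast hq) hi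
  linarith

lemma prod_range_pow_succ_sub_one_ne_zero {q : ℕ} (hq : 2 ≤ q) (r : ℕ) :
    ∏ i ∈ Finset.range r, ((q : ℚ) ^ (i + 1) - 1) ≠ 0 :=
  Finset.prod_ne_zero_iff.2 fun _ _ => natCast_pow_sub_one_ne_zero hq (Nat.succ_ne_zero _)

@[simp]
lemma gaussBinom_zero_right (n q : ℕ) : gaussBinom n 0 q = 1 := by
  simp [gaussBinom]

lemma gaussBinom_eq_zero_of_lt {n r : ℕ} (q : ℕ) (h : n < r) : gaussBinom n r q = 0 := by
  rw [gaussBinom, Finset.prod_eq_zero (Finset.mem_range.2 h) (by simp), zero_div]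

/-- The `q`-analogue of Pascal's rule. -/
lemma gaussBinom_succ_succ {q : ℕ} (hq : 2 ≤ q) (n r : ℕ) :
    gaussBinom (n + 1) (r + 1) q =
      gaussBinom n r q + (q : ℚ) ^ (r + 1) * gaussBinom n (r + 1) q := by
  rcases lt_or_ge n r with h | h
  · rw [gaussBinom_eq_zero_of_lt q h, gaussBinom_eq_zero_of_lt q (by omega),
      gaussBinom_eq_zero_of_lt q (by omega)]
    simp
  · have h1 := prod_range_pow_succ_sub_one_ne_zero hq r
    have h2 := natCast_pow_sub_one_ne_zero hq (Nat.succ_ne_zero r)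
    have h3 : (q : ℚ) ^ (n + 1) = (q : ℚ) ^ (r + 1) * (q : ℚ) ^ (n - r) := by
      rw [← pow_add]; congr 1; omega
    simp only [gaussBinom]
    rw [Finset.prod_range_succ' (fun i => (q : ℚ) ^ (n + 1 - i) - 1),
      Finset.prod_range_succ (fun i => (q : ℚ) ^ (i + 1) - 1),
      Finset.prod_range_succ (fun i => (q : ℚ) ^ (n - i) - 1)]
    simp only [Nat.add_sub_add_right, Nat.sub_zero]
    rw [Nat.succ_eq_add_one] at h2
    field_simp
    rw [h3]
    ring

lemma exists_natCast_eq_gaussBinom {q : ℕ} (hq : 2 ≤ q) (n r : ℕ) :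
    ∃ k : ℕ, (k : ℚ) = gaussBinom n r q := by
  induction n generalizing r with
  | zero =>
    cases r with
    | zero => exact ⟨1, by simp⟩
    | succ r => exact ⟨0, by rw [gaussBinom_eq_zero_of_lt q (Nat.succ_pos r)]; simp⟩
  | succ n ih =>
    cases r with
    | zero => exact ⟨1, by simp⟩
    | succ r =>
      obtain ⟨a, ha⟩ := ih r
      obtain ⟨b, hb⟩ := ih (r + 1)
      exact ⟨a + q ^ (r + 1) * b, by rw [gaussBinom_succ_succ hq, ← ha, ← hb]; push_cast; rfl⟩

lemma gaussBinom_nonneg {q : ℕ} (hq : 2 ≤ q) (n r : ℕ) : 0 ≤ gaussBinom n r q := by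
  obtain ⟨k, hk⟩ := exists_natCast_eq_gaussBinom hq n r
  rw [← hk]; positivity

/-- The Gaussian binomial coefficient as a quotient of `q`-factorials, in the form that makes the
symmetries of multinomial coefficients evident. -/
lemma gaussBinom_mul_prod_mul_prod {q : ℕ} (hq : 2 ≤ q) (r s : ℕ) :
    gaussBinom (r + s) r q * (∏ i ∈ Finset.range r, ((q : ℚ) ^ (i + 1) - 1)) *
      (∏ i ∈ Finset.range s, ((q : ℚ) ^ (i + 1) - 1)) =
      ∏ i ∈ Finset.range (r + s), ((q : ℚ) ^ (i + 1) - 1) := by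
  rw [gaussBinom, div_mul_cancel₀ _ (prod_range_pow_succ_sub_one_ne_zero hq r), add_comm r s,
    Finset.prod_range_add, mul_comm, ← Finset.prod_range_reflect (n := r)]
  congr 1
  refine Finset.prod_congr rfl fun i hi => ?_
  have := Finset.mem_range.1 hi
  congr 2
  omega

lemma gaussBinom_self {q : ℕ} (hq : 2 ≤ q) (r : ℕ) : gaussBinom r r q = 1 := by
  have h := gaussBinom_mul_prod_mul_prod hq r 0
  simp only [add_zero, Finset.range_zero, Finset.prod_empty, mul_one] at h
  exact mul_right_cancel₀ (prod_range_pow_succ_sub_one_ne_zero hq r) (by rw [h, one_mul])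

lemma gaussBinom_mul_gaussBinom {q : ℕ} (hq : 2 ≤ q) {r s j : ℕ} (hjs : j ≤ s) (hsr : s ≤ r) :
    gaussBinom r s q * gaussBinom s j q =
      gaussBinom r j q * gaussBinom (r - j) (s - j) q := by
  obtain ⟨a, rfl⟩ := Nat.exists_eq_add_of_le hjs
  obtain ⟨b, rfl⟩ := Nat.exists_eq_add_of_le hsr
  have e1 : j + a + b - j = a + b := by omega
  have e2 : j + a - j = a := by omega
  rw [e1, e2]
  have h1 := gaussBinom_mul_prod_mul_prod hq (j + a) b
  have h2 := gaussBinom_mul_prod_mul_prod hq j a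
  have h3 := gaussBinom_mul_prod_mul_prod hq j (a + b)
  have h4 := gaussBinom_mul_prod_mul_prod hq a b
  rw [← add_assoc] at h3
  have n1 := prod_range_pow_succ_sub_one_ne_zero hq j
  have n2 := prod_range_pow_succ_sub_one_ne_zero hq a
  have n3 := prod_range_pow_succ_sub_one_ne_zero hq b
  refine mul_right_cancel₀ (mul_ne_zero (mul_ne_zero n1 n2) n3) ?_
  rw [← h2] at h1
  rw [← h4] at h3
  linear_combination h1 - h3

lemma sum_neg_one_pow_mul_gaussBinom {q : ℕ} (hq : 2 ≤ q) (k : ℕ) :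
    ∑ t ∈ Finset.range (k + 2),
      (-1 : ℚ) ^ t * (q : ℚ) ^ (Nat.choose t 2) * gaussBinom (k + 1) t q = 0 := by
  -- by Pascal's rule the sum telescopes
  have key : ∀ m : ℕ, ∑ t ∈ Finset.range (m + 1),
      (-1 : ℚ) ^ t * (q : ℚ) ^ (Nat.choose t 2) * gaussBinom (k + 1) t q =
      (-1 : ℚ) ^ m * (q : ℚ) ^ (Nat.choose (m + 1) 2) * gaussBinom k m q := by
    intro m
    induction m with
    | zero => simp
    | succ m ih =>
      rw [Finset.sum_range_succ, ih, gaussBinom_succ_succ hq,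
        Nat.choose_succ_succ' (m + 1) 1, Nat.choose_one_right]
      ring
  rw [key (k + 1), gaussBinom_eq_zero_of_lt q (Nat.lt_succ_self k), mul_zero]

/-- Gaussian inversion: summing the alternating sums with weights `[r s]_q` recovers `h r`. -/
lemma sum_gaussBinom_mul_sum_neg_one_pow {q : ℕ} (hq : 2 ≤ q) (h : ℕ → ℚ) (r : ℕ) :
    ∑ s ∈ Finset.range (r + 1), gaussBinom r s q *
      ∑ j ∈ Finset.range (s + 1),
        (-1 : ℚ) ^ (s - j) * gaussBinom s j q * (q : ℚ) ^ (Nat.choose (s - j) 2) * h j = h r := by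
  simp only [Finset.mul_sum]
  rw [Finset.sum_sigma', Finset.sum_bij' (s := (Finset.range (r + 1)).sigma fun s => Finset.range (s + 1))
    (t := (Finset.range (r + 1)).sigma fun j => Finset.range (r - j + 1))
    (g := fun x => gaussBinom r x.1 q * h x.1 * ((-1 : ℚ) ^ x.2 * (q : ℚ) ^ (Nat.choose x.2 2) *
      gaussBinom (r - x.1) x.2 q))
    (i := fun x _ => ⟨x.2, x.1 - x.2⟩) (j := fun x _ => ⟨x.1 + x.2, x.1⟩)]
  · rw [Finset.sum_sigma, Finset.sum_range_succ, Finset.sum_eq_zero]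
    · simp only [Nat.sub_self, zero_add, Finset.sum_range_one]
      simp [gaussBinom_self hq]
    · intro j hj
      have hj := Finset.mem_range.1 hj
      obtain ⟨k, hk⟩ : ∃ k, r - j = k + 1 := ⟨r - j - 1, by omega⟩
      simp only [hk]
      rw [← Finset.mul_sum, sum_neg_one_pow_mul_gaussBinom hq, mul_zero]
  · rintro ⟨s, j⟩ hx
    simp only [Finset.mem_sigma, Finset.mem_range] at hx ⊢
    omega
  · rintro ⟨s, j⟩ hx
    simp only [Finset.mem_sigma, Finset.mem_range] at hx ⊢
    omega
  · rintro ⟨s, j⟩ hx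
    simp only [Finset.mem_sigma, Finset.mem_range] at hx
    simp only [Sigma.mk.injEq, heq_eq_eq, and_true]
    omega
  · rintro ⟨s, j⟩ hx
    simp
  · rintro ⟨s, j⟩ hx
    simp only [Finset.mem_sigma, Finset.mem_range] at hx
    have := gaussBinom_mul_gaussBinom hq (r := r) (s := s) (j := j) (by omega) (by omega)
    simp only
    linear_combination ((-1 : ℚ) ^ (s - j) * (q : ℚ) ^ (Nat.choose (s - j) 2) * h j) * this

/-! ### Counting subspaces, and Möbius inversion over them -/

section Counting

variable {F V : Type*} [Field F] [AddCommGroup V] [Module F V]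

lemma exists_submodule_finrank_eq {r : ℕ} (h : r ≤ finrank F V) :
    ∃ W : Submodule F V, finrank F W = r := by
  obtain ⟨f, hf⟩ := exists_linearIndependent_of_le_finrank h
  exact ⟨Submodule.span F (Set.range f), by rw [finrank_span_eq_card hf, Fintype.card_fin]⟩

variable [FiniteDimensional F V]

lemma span_range_subtype_of_linearIndependent {r : ℕ} {W : Submodule F V} (hW : finrank F W = r)
    {t : Fin r → W} (ht : LinearIndependent F t) :
    Submodule.span F (Set.range (W.subtype ∘ t)) = W := by
  refine Submodule.eq_of_le_of_finrank_eq (Submodule.span_le.2 ?_) ?_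
  · rintro _ ⟨i, rfl⟩
    exact (t i).2
  · rw [finrank_span_eq_card (ht.map' W.subtype (Submodule.ker_subtype _)), Fintype.card_fin, hW]

variable [Finite F]

lemma two_le_natCard_field (F : Type*) [Field F] [Finite F] : 2 ≤ Nat.card F :=
  Finite.one_lt_card

lemma finite_submodule (F V : Type*) [Field F] [Finite F] [AddCommGroup V] [Module F V]
    [FiniteDimensional F V] : Finite (Submodule F V) := by
  have : Finite V := Module.finite_of_finite F
  exact Finite.of_injective (fun W : Submodule F V => (W : Set V)) SetLike.coe_injective

/-- A linearly independent family of `r` vectors amounts to an `r`-dimensional subspace, its span,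
together with a basis of it. -/
lemma natCard_linearIndependent_eq_sum (r : ℕ)
    [Fintype {W : Submodule F V // finrank F W = r}] :
    Nat.card {s : Fin r → V // LinearIndependent F s} =
      ∑ W : {W : Submodule F V // finrank F W = r},
        Nat.card {t : Fin r → W.1 // LinearIndependent F t} := by
  have : Finite V := Module.finite_of_finite F
  let f : {s : Fin r → V // LinearIndependent F s} → {W : Submodule F V // finrank F W = r} :=
    fun s => ⟨Submodule.span F (Set.range s.1), by
      rw [finrank_span_eq_card s.2, Fintype.card_fin]⟩
  rw [← Nat.card_congr (Equiv.sigmaFiberEquiv f), Nat.card_sigma]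
  refine Finset.sum_congr rfl fun W _ => (Nat.card_eq_of_bijective
    (fun t : {t : Fin r → W.1 // LinearIndependent F t} =>
      (⟨⟨W.1.subtype ∘ t.1, t.2.map' _ (Submodule.ker_subtype _)⟩,
        Subtype.ext (span_range_subtype_of_linearIndependent W.2 t.2)⟩ : {s // f s = W})) ⟨?_, ?_⟩).symm
  · intro t t' h
    refine Subtype.ext (funext fun i => Subtype.ext ?_)
    exact congr_fun (congr_arg (fun x => x.1.1) h) i
  · rintro ⟨⟨s, hs⟩, h⟩
    have hmem : ∀ i, s i ∈ W.1 := fun i => by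
      rw [← congr_arg Subtype.val h]
      exact Submodule.subset_span ⟨i, rfl⟩
    refine ⟨⟨fun i => ⟨s i, hmem i⟩, LinearIndependent.of_comp W.1.subtype hs⟩, rfl⟩

lemma natCard_linearIndependent {r : ℕ} (hr : r ≤ finrank F V) :
    (Nat.card {s : Fin r → V // LinearIndependent F s} : ℚ) =
      (∏ i ∈ Finset.range r, (Nat.card F : ℚ) ^ i) *
        ∏ i ∈ Finset.range r, ((Nat.card F : ℚ) ^ (finrank F V - i) - 1) := by
  have := Fintype.ofFinite F
  have : Finite V := Module.finite_of_finite F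
  rw [card_linearIndependent hr, Finset.prod_range, Finset.prod_range, ← Finset.prod_mul_distrib,
    Nat.cast_prod, ← Nat.card_eq_fintype_card]
  refine Finset.prod_congr rfl fun i _ => ?_
  have h1 : Nat.card F ^ (i : ℕ) ≤ Nat.card F ^ finrank F V :=
    Nat.pow_le_pow_right (by have := two_le_natCard_field F; omega) (by omega)
  rw [Nat.cast_sub h1, mul_sub, ← pow_add, Nat.add_sub_cancel' (by omega)]
  push_cast
  ring

/-- The number of `r`-dimensional subspaces is a Gaussian binomial coefficient. -/
theorem natCard_submodule_finrank_eq (r : ℕ) :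
    (Nat.card {W : Submodule F V // finrank F W = r} : ℚ) =
      gaussBinom (finrank F V) r (Nat.card F) := by
  have hq := two_le_natCard_field F
  rcases lt_or_ge (finrank F V) r with h | h
  · rw [gaussBinom_eq_zero_of_lt _ h]
    have : IsEmpty {W : Submodule F V // finrank F W = r} :=
      ⟨fun W => absurd (Submodule.finrank_le W.1) (by rw [W.2]; omega)⟩
    simp
  · have := finite_submodule F V
    have := Fintype.ofFinite {W : Submodule F V // finrank F W = r}
    have : Finite V := Module.finite_of_finite F
    have h1 := natCard_linearIndependent (F := F) (V := V) h
    rw [natCard_linearIndependent_eq_sum, Nat.cast_sum] at h1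
    have h2 : ∀ W : {W : Submodule F V // finrank F W = r},
        (Nat.card {s : Fin r → W.1 // LinearIndependent F s} : ℚ) =
        (∏ i ∈ Finset.range r, (Nat.card F : ℚ) ^ i) *
          ∏ i ∈ Finset.range r, ((Nat.card F : ℚ) ^ (i + 1) - 1) := by
      intro W
      rw [natCard_linearIndependent W.2.ge, W.2,
        ← Finset.prod_range_reflect (fun i => (Nat.card F : ℚ) ^ (i + 1) - 1)]
      congr 1
      refine Finset.prod_congr rfl fun i hi => ?_
      have := Finset.mem_range.1 hi
      congr 2
      omega
    rw [Finset.sum_congr rfl fun W _ => h2 W, Finset.sum_const, nsmul_eq_mul, Finset.card_univ,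
      ← Nat.card_eq_fintype_card] at h1
    have n1 : ∏ i ∈ Finset.range r, (Nat.card F : ℚ) ^ i ≠ 0 :=
      Finset.prod_ne_zero_iff.2 fun i _ => pow_ne_zero _ (by positivity)
    rw [gaussBinom, eq_div_iff (prod_range_pow_succ_sub_one_ne_zero hq r)]
    exact mul_left_cancel₀ n1 (by linear_combination h1)

lemma natCard_submodule_le_finrank_eq (X : Submodule F V) (r : ℕ) :
    (Nat.card {W : Submodule F V // W ≤ X ∧ finrank F W = r} : ℚ) =
      gaussBinom (finrank F X) r (Nat.card F) := by
  rw [← natCard_submodule_finrank_eq (F := F) (V := X) r]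
  congr 1
  refine (Nat.card_congr ?_).symm
  refine ((Submodule.MapSubtype.orderIso X).toEquiv.subtypeEquiv
    (p := fun W : Submodule F X => finrank F W = r)
    (q := fun W : {W : Submodule F V // W ≤ X} => finrank F W.1 = r) fun W => ?_).trans
    (Equiv.subtypeSubtypeEquivSubtypeInter (· ≤ X) fun W => finrank F W = r)
  show _ ↔ finrank F (W.map X.subtype) = r
  rw [(Submodule.equivMapOfInjective X.subtype X.injective_subtype W).finrank_eq]

lemma sum_submodule_le_eq_sum_gaussBinom [Fintype (Submodule F V)] (X : Submodule F V)
    (g : ℕ → ℚ) [DecidablePred (· ≤ X)] :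
    ∑ Y with Y ≤ X, g (finrank F Y) =
      ∑ s ∈ Finset.range (finrank F X + 1), gaussBinom (finrank F X) s (Nat.card F) * g s := by
  classical
  rw [← Finset.sum_fiberwise_of_maps_to (s := Finset.univ.filter fun Y : Submodule F V => Y ≤ X)
    (t := Finset.range (finrank F X + 1)) (g := fun Y : Submodule F V => finrank F Y)]
  · refine Finset.sum_congr rfl fun s _ => ?_
    rw [Finset.sum_congr rfl fun Y hY => by rw [(Finset.mem_filter.1 hY).2], Finset.sum_const,
      nsmul_eq_mul, ← natCard_submodule_le_finrank_eq X s, Finset.filter_filter,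
      Nat.card_eq_fintype_card, Fintype.card_subtype]
  · intro Y hY
    exact Finset.mem_range.2 (Nat.lt_succ_of_le (Submodule.finrank_mono (Finset.mem_filter.1 hY).2))

/-- Möbius inversion over the lattice of subspaces, for functions of the dimension. -/
theorem eq_sum_of_forall_sum_submodule_le [Fintype (Submodule F V)] [DecidableLE (Submodule F V)]
    (P : Submodule F V → ℚ) (h : ℕ → ℚ)
    (hP : ∀ X : Submodule F V, ∑ Y with Y ≤ X, P Y = h (finrank F X)) (X : Submodule F V) :
    P X = ∑ j ∈ Finset.range (finrank F X + 1), (-1 : ℚ) ^ (finrank F X - j) *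
      gaussBinom (finrank F X) j (Nat.card F) *
        (Nat.card F : ℚ) ^ (Nat.choose (finrank F X - j) 2) * h j := by
  classical
  set g : ℕ → ℚ := fun s => ∑ j ∈ Finset.range (s + 1), (-1 : ℚ) ^ (s - j) *
    gaussBinom s j (Nat.card F) * (Nat.card F : ℚ) ^ (Nat.choose (s - j) 2) * h j with hg
  change P X = g (finrank F X)
  induction hd : finrank F X using Nat.strong_induction_on generalizing X with
  | _ d ih =>
    have h1 := sum_submodule_le_eq_sum_gaussBinom X g
    rw [sum_gaussBinom_mul_sum_neg_one_pow (two_le_natCard_field F), ← hP X] at h1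
    have hX : X ∈ Finset.univ.filter (fun Y : Submodule F V => Y ≤ X) := by simp
    rw [← Finset.add_sum_erase _ _ hX, ← Finset.add_sum_erase _ P hX] at h1
    have h2 : ∑ Y ∈ (Finset.univ.filter fun Y : Submodule F V => Y ≤ X).erase X, g (finrank F Y) =
        ∑ Y ∈ (Finset.univ.filter fun Y : Submodule F V => Y ≤ X).erase X, P Y := by
      refine Finset.sum_congr rfl fun Y hY => ?_
      simp only [Finset.mem_erase, Finset.mem_filter, Finset.mem_univ, true_and] at hY
      exact (ih _ (hd ▸ Submodule.finrank_lt_finrank_of_lt (lt_of_le_of_ne hY.2 hY.1)) Y rfl).symm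
    rw [h2] at h1
    rw [← hd]
    linarith

end Counting

/-! ### Maximum rank distance codes of minimum distance two -/

section RankDistance

variable {F E₁ E₂ : Type*} [Field F] [AddCommGroup E₁] [Module F E₁]
  [AddCommGroup E₂] [Module F E₂]

/-- A linear maximum rank distance code with minimum rank distance two, described by the sizes of
its shortenings: for every nonzero `X ≤ E₂`, the codewords with range inside `X` are
`q ^ (dim E₁ * (dim X - 1))` in number. For one-dimensional `X` this says that no codeword has
rank one. -/
def IsMRDCode (L : Submodule F (E₁ →ₗ[F] E₂)) : Prop :=
  ∀ X : Submodule F E₂, X ≠ ⊥ →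
    Nat.card {φ : E₁ →ₗ[F] E₂ // φ ∈ L ∧ LinearMap.range φ ≤ X} =
      Nat.card F ^ (finrank F E₁ * (finrank F X - 1))

lemma exists_field_extension (F : Type*) [Field F] [Finite F] (n : ℕ) (hn : n ≠ 0) :
    ∃ (K : Type) (_ : Field K) (_ : Algebra F K), finrank F K = n := by
  obtain ⟨p, hp⟩ := CharP.exists F
  have : Fact p.Prime := ⟨CharP.char_is_prime F p⟩
  have : NeZero n := ⟨hn⟩
  exact ⟨FiniteField.Extension F p n, inferInstance, inferInstance,
    FiniteField.finrank_extension F p n⟩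

/-- Identifying both spaces with the field extension `K` of `F` of the right degree, the code
consists of the maps `φ` with `tr (φ ∘ (a * ·)) = 0` for all `a ∈ K`. On the maps `f ⊗ v` with
`v ≠ 0` fixed this condition defines a bijection from the functionals `f` to the dual of `K`,
so the `dim K` conditions are independent on every shortening. -/
theorem exists_isMRDCode [Finite F] [FiniteDimensional F E₁] [FiniteDimensional F E₂]
    (h : finrank F E₁ = finrank F E₂) (h0 : finrank F E₂ ≠ 0) :
    ∃ L : Submodule F (E₁ →ₗ[F] E₂), IsMRDCode L := by
  obtain ⟨K, _, _, hK⟩ := exists_field_extension F (finrank F E₂) h0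
  have : FiniteDimensional F K := FiniteDimensional.of_finrank_pos (by omega)
  let e₁ : E₁ ≃ₗ[F] K := LinearEquiv.ofFinrankEq _ _ (by omega)
  let e₂ : E₂ ≃ₗ[F] K := LinearEquiv.ofFinrankEq _ _ (by omega)
  let μ : K →ₗ[F] E₂ →ₗ[F] E₁ :=
    (LinearMap.llcomp F E₂ K E₁ e₁.symm.toLinearMap) ∘ₗ
      (LinearMap.lcomp F K e₂.toLinearMap) ∘ₗ (LinearMap.mul F K)
  have hμ : ∀ a v, μ a v = e₁.symm (a * e₂ v) := fun a v => rfl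
  let T : (E₁ →ₗ[F] E₂) →ₗ[F] (K →ₗ[F] F) :=
    LinearMap.mk₂ F (fun φ a => LinearMap.trace F E₂ (φ ∘ₗ μ a))
      (fun φ ψ a => by rw [LinearMap.add_comp, map_add])
      (fun c φ a => by rw [LinearMap.smul_comp, map_smul])
      (fun φ a b => by rw [map_add, LinearMap.comp_add, map_add])
      (fun c φ a => by rw [map_smul, LinearMap.comp_smul, map_smul])
  refine ⟨LinearMap.ker T, fun X hX => ?_⟩
  let R : (E₁ →ₗ[F] X) →ₗ[F] (E₁ →ₗ[F] E₂) := LinearMap.compRight F X.subtype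
  have hsurj : Function.Surjective (T ∘ₗ R) := by
    obtain ⟨v, hv, hv0⟩ := Submodule.exists_mem_ne_zero_of_ne_bot hX
    intro g
    let f : E₁ →ₗ[F] F := g ∘ₗ (LinearMap.mulRight F (e₂ v)⁻¹) ∘ₗ e₁.toLinearMap
    refine ⟨f.smulRight ⟨v, hv⟩, LinearMap.ext fun a => ?_⟩
    have h1 : (R (f.smulRight ⟨v, hv⟩)) ∘ₗ μ a = (f ∘ₗ μ a).smulRight v := rfl
    have h2 : e₂ v ≠ 0 := by simpa using hv0
    change LinearMap.trace F E₂ ((R (f.smulRight ⟨v, hv⟩)) ∘ₗ μ a) = g a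
    rw [h1, LinearMap.trace_smulRight]
    simp [f, hμ, h2]
  have hcard : finrank F (LinearMap.ker (T ∘ₗ R)) = finrank F E₁ * (finrank F X - 1) := by
    have h1 := LinearMap.finrank_range_add_finrank_ker (T ∘ₗ R)
    rw [LinearMap.range_eq_top.2 hsurj, finrank_top, Module.finrank_linearMap,
      Module.finrank_linearMap, Module.finrank_self, mul_one, hK, ← h] at h1
    rw [Nat.mul_sub, mul_one]
    omega
  rw [← hcard, ← Module.natCard_eq_pow_finrank (K := F) (V := LinearMap.ker (T ∘ₗ R))]
  refine Nat.card_congr ⟨fun φ => ⟨LinearMap.codRestrict X φ.1 fun x => φ.2.2 ⟨x, rfl⟩, φ.2.1⟩,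
    fun ψ => ⟨R ψ.1, ψ.2, ?_⟩, fun φ => rfl, fun ψ => rfl⟩
  rintro _ ⟨x, rfl⟩
  exact (ψ.1 x).2

variable {L : Submodule F (E₁ →ₗ[F] E₂)}

lemma finite_linearMap (F E₁ E₂ : Type*) [Field F] [AddCommGroup E₁] [Module F E₁]
    [AddCommGroup E₂] [Module F E₂] [FiniteDimensional F E₁] [FiniteDimensional F E₂] [Finite F] :
    Finite (E₁ →ₗ[F] E₂) :=
  Module.finite_of_finite F

lemma IsMRDCode.two_le_finrank_range (hL : IsMRDCode L) {φ : E₁ →ₗ[F] E₂} (hφ : φ ∈ L)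
    (h0 : φ ≠ 0) : 2 ≤ finrank F (LinearMap.range φ) := by
  by_contra! h
  have hne : LinearMap.range φ ≠ ⊥ := fun h => h0 (LinearMap.range_eq_bot.1 h)
  have h1 := hL _ hne
  have h2 : finrank F (LinearMap.range φ) - 1 = 0 := by omega
  rw [h2, mul_zero, pow_zero, Nat.card_eq_one_iff_unique] at h1
  have := congr_arg Subtype.val (h1.1.elim ⟨φ, hφ, le_rfl⟩ ⟨0, L.zero_mem, by simp⟩)
  exact h0 this

lemma IsMRDCode.natCard (hL : IsMRDCode L) (h : finrank F E₂ ≠ 0) :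
    Nat.card L = Nat.card F ^ (finrank F E₁ * (finrank F E₂ - 1)) := by
  have : Nontrivial E₂ := Module.nontrivial_of_finrank_pos (R := F) (by omega)
  have h1 := hL ⊤ top_ne_bot
  rw [finrank_top] at h1
  rw [← h1]
  exact Nat.card_congr (Equiv.subtypeEquivRight fun φ => by simp)

variable [FiniteDimensional F E₁] [FiniteDimensional F E₂] [Finite F]

/-- The number of codewords with a prescribed `r`-dimensional range, for a maximum rank distance
code of minimum rank distance two in `n × n` matrices over the field with `q` elements. -/
def mrdRangeCount (n r q : ℕ) : ℚ :=
  ∑ j ∈ Finset.Icc 2 r, (-1 : ℚ) ^ (r - j) * gaussBinom r j q * (q : ℚ) ^ (Nat.choose (r - j) 2)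
    * ((q : ℚ) ^ (n * (j - 1)) - 1)

lemma natCard_eq_sum_natCard_range [Fintype (Submodule F E₂)] (p : (E₁ →ₗ[F] E₂) → Prop)
    (t : Submodule F E₂ → Prop) [DecidablePred t] :
    Nat.card {φ : E₁ →ₗ[F] E₂ // p φ ∧ t (LinearMap.range φ)} =
      ∑ Y with t Y, Nat.card {φ : E₁ →ₗ[F] E₂ // p φ ∧ LinearMap.range φ = Y} := by
  classical
  have := finite_linearMap F E₁ E₂
  have := Fintype.ofFinite (E₁ →ₗ[F] E₂)
  simp only [Nat.card_eq_fintype_card, Fintype.card_subtype]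
  rw [Finset.card_eq_sum_card_fiberwise (t := Finset.univ.filter t) (f := LinearMap.range)]
  · refine Finset.sum_congr rfl fun Y hY => ?_
    rw [Finset.filter_filter]
    congr 1
    ext φ
    have := (Finset.mem_filter.1 hY).2
    simp only [Finset.mem_filter, Finset.mem_univ, true_and]
    constructor
    · rintro ⟨⟨h1, -⟩, h2⟩
      exact ⟨h1, h2⟩
    · rintro ⟨h1, rfl⟩
      exact ⟨⟨h1, this⟩, rfl⟩
  · intro φ hφ
    simp_all

theorem IsMRDCode.natCard_range_eq (hL : IsMRDCode L) {X : Submodule F E₂} (hX : X ≠ ⊥) :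
    (Nat.card {φ : E₁ →ₗ[F] E₂ // φ ∈ L ∧ LinearMap.range φ = X} : ℚ) =
      mrdRangeCount (finrank F E₁) (finrank F X) (Nat.card F) := by
  classical
  have := finite_submodule F E₂
  have := Fintype.ofFinite (Submodule F E₂)
  -- the zero map is discounted, so that the function of `dim X` vanishes in dimensions `0` and `1`
  have hbot : Nat.card {φ : E₁ →ₗ[F] E₂ // φ ∈ L ∧ LinearMap.range φ = ⊥} = 1 := by
    rw [Nat.card_eq_one_iff_unique]
    refine ⟨⟨fun φ ψ => Subtype.ext ?_⟩, ⟨0, L.zero_mem, LinearMap.range_zero⟩⟩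
    rw [LinearMap.range_eq_bot.1 φ.2.2, LinearMap.range_eq_bot.1 ψ.2.2]
  have key := eq_sum_of_forall_sum_submodule_le (F := F) (V := E₂)
    (fun Y => (Nat.card {φ : E₁ →ₗ[F] E₂ // φ ∈ L ∧ LinearMap.range φ = Y} : ℚ) -
      if Y = ⊥ then 1 else 0)
    (fun j => (Nat.card F : ℚ) ^ (finrank F E₁ * (j - 1)) - 1) (fun Y => ?_) X
  · simp only [hX, if_false, sub_zero] at key
    rw [key, mrdRangeCount]
    refine (Finset.sum_subset (fun j hj => ?_) fun j hj hj' => ?_).symm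
    · simp only [Finset.mem_Icc, Finset.mem_range] at hj ⊢
      omega
    · simp only [Finset.mem_Icc, Finset.mem_range] at hj hj'
      have : j - 1 = 0 := by omega
      rw [this]
      simp
  · rw [Finset.sum_sub_distrib, ← Nat.cast_sum, ← natCard_eq_sum_natCard_range (· ∈ L) (· ≤ Y)]
    have h1 : ∑ Z with Z ≤ Y, (if Z = (⊥ : Submodule F E₂) then (1 : ℚ) else 0) = 1 := by
      rw [Finset.sum_ite_eq' _ ⊥ (fun _ => (1 : ℚ))]
      simp
    rw [h1]
    rcases eq_or_ne Y ⊥ with rfl | hY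
    · simp only [le_bot_iff, hbot]
      simp
    · rw [hL Y hY]
      push_cast
      rfl

/-- The rank distribution of the code: the number of codewords of rank at most `k`. -/
theorem IsMRDCode.natCard_finrank_range_le (hL : IsMRDCode L) (k : ℕ) :
    (Nat.card {φ : E₁ →ₗ[F] E₂ // φ ∈ L ∧ finrank F (LinearMap.range φ) ≤ k} : ℚ) =
      ∑ r ∈ Finset.Icc 2 k, gaussBinom (finrank F E₂) r (Nat.card F) *
        mrdRangeCount (finrank F E₁) r (Nat.card F) + 1 := by
  classical
  have := finite_submodule F E₂
  have := Fintype.ofFinite (Submodule F E₂)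
  have := finite_linearMap F E₁ E₂
  have := Fintype.ofFinite (E₁ →ₗ[F] E₂)
  have h0 : Nat.card {φ : E₁ →ₗ[F] E₂ // φ ∈ L ∧ finrank F (LinearMap.range φ) ≤ k} =
      Nat.card {φ : E₁ →ₗ[F] E₂ // φ ∈ L ∧ finrank F (LinearMap.range φ) ∈ Finset.Icc 2 k} + 1 := by
    simp only [Nat.card_eq_fintype_card, Fintype.card_subtype]
    rw [← Finset.card_insert_of_notMem (a := (0 : E₁ →ₗ[F] E₂))]
    · congr 1
      ext φ
      simp only [Finset.mem_filter, Finset.mem_univ, true_and, Finset.mem_insert, Finset.mem_Icc]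
      constructor
      · rintro ⟨h1, h2⟩
        rcases eq_or_ne φ 0 with h | h
        · exact Or.inl h
        · exact Or.inr ⟨h1, hL.two_le_finrank_range h1 h, h2⟩
      · rintro (rfl | h)
        · exact ⟨L.zero_mem, by rw [LinearMap.range_zero, finrank_bot]; exact Nat.zero_le k⟩
        · exact ⟨h.1, h.2.2⟩
    · rw [Finset.mem_filter, LinearMap.range_zero, finrank_bot]
      simp
  rw [h0, natCard_eq_sum_natCard_range (· ∈ L) (fun Y => finrank F Y ∈ Finset.Icc 2 k)]
  push_cast
  congr 1
  rw [← Finset.sum_fiberwise_of_maps_to (t := Finset.Icc 2 k)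
    (g := fun Y : Submodule F E₂ => finrank F Y)]
  · refine Finset.sum_congr rfl fun r hr => ?_
    rw [Finset.filter_filter]
    have h2 : ∀ Y ∈ Finset.univ.filter (fun Y : Submodule F E₂ =>
        finrank F Y ∈ Finset.Icc 2 k ∧ finrank F Y = r),
        (Nat.card {φ : E₁ →ₗ[F] E₂ // φ ∈ L ∧ LinearMap.range φ = Y} : ℚ) =
        mrdRangeCount (finrank F E₁) r (Nat.card F) := by
      intro Y hY
      obtain ⟨-, h3, rfl⟩ := Finset.mem_filter.1 hY
      refine hL.natCard_range_eq fun h => ?_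
      rw [h, finrank_bot] at h3
      simp at h3
    rw [Finset.sum_congr rfl h2, Finset.sum_const, nsmul_eq_mul,
      ← natCard_submodule_finrank_eq (F := F) (V := E₂) r]
    rw [Nat.card_eq_fintype_card (α := {W : Submodule F E₂ // finrank F W = r}),
      Fintype.card_subtype]
    congr 3
    ext Y
    simp only [Finset.mem_filter, Finset.mem_univ, true_and]
    constructor
    · rintro ⟨-, h⟩
      exact h
    · rintro rfl
      exact ⟨hr, rfl⟩
  · intro Y hY
    exact (Finset.mem_filter.1 hY).2

end RankDistance

/-! ### The subspaces obtained by lifting matrix codes -/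

section Lifting

variable {F V V' : Type*} [Field F] [AddCommGroup V] [Module F V] [AddCommGroup V'] [Module F V']

lemma finrank_map_add_finrank_inf_ker [FiniteDimensional F V] (f : V →ₗ[F] V')
    (U : Submodule F V) :
    finrank F (U.map f) + finrank F ↥(U ⊓ LinearMap.ker f) = finrank F U := by
  have h := LinearMap.finrank_range_add_finrank_ker (f.domRestrict U)
  rw [LinearMap.range_domRestrict] at h
  have e : (LinearMap.ker (f.domRestrict U)).map U.subtype = U ⊓ LinearMap.ker f := by
    ext x
    simp [LinearMap.mem_ker, and_comm]
  rw [← h, ← e, (Submodule.equivMapOfInjective U.subtype U.injective_subtype _).finrank_eq]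

/-- Two subspaces of dimension `n` intersect in codimension at least two as soon as a third
subspace cuts one of them in dimension at least two without meeting their intersection. -/
lemma finrank_inf_add_two_le [FiniteDimensional F V] {U U' T : Submodule F V}
    (hU : 2 ≤ finrank F ↥(U ⊓ T)) (hT : U ⊓ T ⊓ U' = ⊥) :
    finrank F ↥(U ⊓ U') + 2 ≤ finrank F U := by
  have h := Submodule.finrank_sup_add_finrank_inf_eq (U ⊓ U') (U ⊓ T)
  have h1 : (U ⊓ U') ⊓ (U ⊓ T) = ⊥ := by
    rw [eq_bot_iff, ← hT]
    exact fun x hx => ⟨hx.2, hx.1.2⟩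
  rw [h1, finrank_bot] at h
  have h2 : finrank F ↥((U ⊓ U') ⊔ (U ⊓ T)) ≤ finrank F U :=
    Submodule.finrank_mono (sup_le inf_le_left inf_le_left)
  omega

lemma subspaceDist_eq [FiniteDimensional F V] {U W : Submodule F V} {n : ℕ}
    (hU : finrank F U = n) (hW : finrank F W = n) :
    subspaceDist U W = 2 * (n - finrank F ↥(U ⊓ W)) := by
  have h := Submodule.finrank_sup_add_finrank_inf_eq U W
  have h1 : finrank F ↥(U ⊓ W) ≤ finrank F U := Submodule.finrank_mono inf_le_left
  rw [subspaceDist]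
  omega

/-- Any family of `n`-dimensional subspaces with pairwise intersections of codimension at least
two, and codimension exactly two for some pair, contains codes of minimum distance four of every
smaller cardinality. -/
lemma exists_isConstantDimensionCode_of_le_card [FiniteDimensional F V] [FiniteDimensional F V']
    (e : V ≃ₗ[F] V') {n r q M : ℕ}
    (hF : Nat.card F = q) (hV : finrank F V' = r) (C : Finset (Submodule F V))
    (hC : ∀ U ∈ C, finrank F U = n)
    (hC' : ∀ U ∈ C, ∀ W ∈ C, U ≠ W → finrank F ↥(U ⊓ W) + 2 ≤ n)
    (h4 : ∃ U ∈ C, ∃ W ∈ C, U ≠ W ∧ finrank F ↥(U ⊓ W) + 2 = n)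
    (hM : 2 ≤ M) (hMC : M ≤ C.card) :
    ∃ D : Finset (Submodule F V'), IsConstantDimensionCode r M 4 n q D := by
  classical
  obtain ⟨U, hU, W, hW, hne, hUW⟩ := h4
  have hsub : ({U, W} : Finset (Submodule F V)) ⊆ C := by
    simp [Finset.insert_subset_iff, hU, hW]
  obtain ⟨D, hD1, hD2, hD3⟩ := Finset.exists_subsuperset_card_eq hsub
    ((Finset.card_pair hne).le.trans hM) hMC
  have hinj : Function.Injective (Submodule.map e.toLinearMap) :=
    Submodule.map_injective_of_injective e.injective
  have hfin : ∀ U : Submodule F V, finrank F (U.map e.toLinearMap) = finrank F U := fun U =>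
    LinearEquiv.finrank_map_eq e U
  have hdist : ∀ U ∈ C, ∀ W ∈ C, subspaceDist (U.map e.toLinearMap) (W.map e.toLinearMap) =
      2 * (n - finrank F ↥(U ⊓ W)) := by
    intro U hU W hW
    rw [subspaceDist_eq (n := n) (by rw [hfin, hC U hU]) (by rw [hfin, hC W hW]),
      ← Submodule.map_inf _ e.injective, hfin]
  refine ⟨D.image (Submodule.map e.toLinearMap), hF, hV, ?_, ?_, ?_, ?_⟩
  · rw [Finset.card_image_of_injective _ hinj, hD3]
  · simp only [Finset.mem_image]
    rintro _ ⟨U, hU, rfl⟩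
    rw [hfin, hC U (hD2 hU)]
  · refine ⟨_, Finset.mem_image_of_mem _ (hD1 (Finset.mem_insert_self _ _)), _,
      Finset.mem_image_of_mem _ (hD1 (Finset.mem_insert_of_mem (Finset.mem_singleton_self _))),
      fun h => hne (hinj h), ?_⟩
    rw [hdist U hU W hW]
    omega
  · rintro _ ⟨_, hU', _, hW', hne, rfl⟩
    obtain ⟨U, hU, rfl⟩ := Finset.mem_image.1 hU'
    obtain ⟨W, hW, rfl⟩ := Finset.mem_image.1 hW'
    rw [hdist U (hD2 hU) W (hD2 hW)]
    have := hC' U (hD2 hU) W (hD2 hW) fun h => hne (by rw [h])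
    omega

variable {S T : Type*} [AddCommGroup S] [Module F S] [AddCommGroup T] [Module F T]

/-- The graph of `φ` with the two factors exchanged. -/
def swappedGraph (φ : T →ₗ[F] S) : Submodule F (S × T) :=
  φ.graph.comap (LinearEquiv.prodComm F S T).toLinearMap

lemma mem_swappedGraph {φ : T →ₗ[F] S} {x : S × T} : x ∈ swappedGraph φ ↔ x.1 = φ x.2 :=
  Iff.rfl

lemma graph_inf_ker_fst (φ : S →ₗ[F] T) : φ.graph ⊓ LinearMap.ker (LinearMap.fst F S T) = ⊥ := by
  rw [eq_bot_iff]
  rintro ⟨x, y⟩ ⟨h1, h2⟩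
  simp only [LinearMap.mem_ker, LinearMap.fst_apply, SetLike.mem_coe, LinearMap.mem_graph_iff]
    at h1 h2
  subst h2
  simp [h1]

lemma swappedGraph_inf_ker_snd (φ : T →ₗ[F] S) :
    swappedGraph φ ⊓ LinearMap.ker (LinearMap.snd F S T) = ⊥ := by
  rw [eq_bot_iff]
  rintro ⟨x, y⟩ ⟨h1, h2⟩
  simp only [LinearMap.mem_ker, LinearMap.snd_apply, SetLike.mem_coe, mem_swappedGraph] at h1 h2
  subst h2
  simp [h1]

/-- `D` consists of subspaces of dimension `n` that meet both factors of `S × T` in dimension at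
least two, and that pairwise intersect in codimension at least two. Such a family is compatible
with the graphs over either factor. -/
structure IsBalancedCode (n : ℕ) (D : Finset (Submodule F (S × T))) : Prop where
  finrank_eq : ∀ U ∈ D, finrank F U = n
  two_le_fst : ∀ U ∈ D, 2 ≤ finrank F ↥(U ⊓ LinearMap.ker (LinearMap.fst F S T))
  two_le_snd : ∀ U ∈ D, 2 ≤ finrank F ↥(U ⊓ LinearMap.ker (LinearMap.snd F S T))
  inf_le : ∀ U ∈ D, ∀ W ∈ D, U ≠ W → finrank F ↥(U ⊓ W) + 2 ≤ n

/-- An indexed family whose members for distinct indices intersect in codimension at least two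
has as many members as indices. -/
lemma exists_isBalancedCode_card_eq {ι : Type*} [Finite ι] {n : ℕ} (U : ι → Submodule F (S × T))
    (h1 : ∀ i, finrank F (U i) = n)
    (h2 : ∀ i, 2 ≤ finrank F ↥(U i ⊓ LinearMap.ker (LinearMap.fst F S T)))
    (h3 : ∀ i, 2 ≤ finrank F ↥(U i ⊓ LinearMap.ker (LinearMap.snd F S T)))
    (h4 : ∀ i j, i ≠ j → finrank F ↥(U i ⊓ U j) + 2 ≤ n) :
    ∃ D : Finset (Submodule F (S × T)), IsBalancedCode n D ∧ D.card = Nat.card ι := by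
  classical
  have := Fintype.ofFinite ι
  have hinj : Function.Injective U := by
    intro i j hij
    by_contra hne
    have := h4 i j hne
    rw [← hij, inf_idem, h1] at this
    omega
  refine ⟨Finset.univ.image U, ⟨?_, ?_, ?_, ?_⟩, ?_⟩
  · simpa using h1
  · simpa using h2
  · simpa using h3
  · simp only [Finset.mem_image, Finset.mem_univ, true_and]
    rintro _ ⟨i, rfl⟩ _ ⟨j, rfl⟩ hne
    exact h4 i j fun h => hne (by rw [h])
  · rw [Finset.card_image_of_injective _ hinj, Finset.card_univ, Nat.card_eq_fintype_card]

variable [FiniteDimensional F S] [FiniteDimensional F T]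

lemma finrank_graph_inf_graph (φ ψ : S →ₗ[F] T) :
    finrank F ↥(φ.graph ⊓ ψ.graph) + finrank F (LinearMap.range (φ - ψ)) = finrank F S := by
  have e : (φ.graph ⊓ ψ.graph).map (LinearMap.fst F S T) = LinearMap.ker (φ - ψ) := by
    ext x
    simp only [Submodule.mem_map, Submodule.mem_inf, LinearMap.mem_graph_iff, LinearMap.fst_apply,
      LinearMap.mem_ker, LinearMap.sub_apply, sub_eq_zero]
    constructor
    · rintro ⟨y, ⟨h1, h2⟩, rfl⟩
      rw [← h1, h2]
    · intro h
      exact ⟨(x, φ x), ⟨rfl, h⟩, rfl⟩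
  rw [← finrank_map_add_finrank_inf_ker (LinearMap.fst F S T), inf_assoc, graph_inf_ker_fst,
    inf_bot_eq, finrank_bot, add_zero, e, add_comm, LinearMap.finrank_range_add_finrank_ker]

lemma finrank_graph (φ : S →ₗ[F] T) : finrank F φ.graph = finrank F S := by
  have h := finrank_graph_inf_graph φ φ
  rwa [inf_idem, sub_self, LinearMap.range_zero, finrank_bot, add_zero] at h

lemma finrank_swappedGraph_inf_swappedGraph (φ ψ : T →ₗ[F] S) :
    finrank F ↥(swappedGraph φ ⊓ swappedGraph ψ) + finrank F (LinearMap.range (φ - ψ)) =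
      finrank F T := by
  have e : (swappedGraph φ ⊓ swappedGraph ψ).map (LinearEquiv.prodComm F S T).toLinearMap =
      φ.graph ⊓ ψ.graph := by
    rw [swappedGraph, swappedGraph, ← Submodule.comap_inf]
    exact Submodule.map_comap_eq_of_surjective (LinearEquiv.prodComm F S T).surjective _
  rw [← finrank_graph_inf_graph φ ψ, ← e]
  congr 1
  exact (LinearEquiv.finrank_map_eq (LinearEquiv.prodComm F S T) _).symm

lemma finrank_swappedGraph (φ : T →ₗ[F] S) : finrank F (swappedGraph φ) = finrank F T := by
  have h := finrank_swappedGraph_inf_swappedGraph φ φ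
  rwa [inf_idem, sub_self, LinearMap.range_zero, finrank_bot, add_zero] at h

lemma finrank_swappedGraph_inf_ker_fst (φ : T →ₗ[F] S) :
    finrank F ↥(swappedGraph φ ⊓ LinearMap.ker (LinearMap.fst F S T)) +
      finrank F (LinearMap.range φ) = finrank F T := by
  have h : LinearMap.ker (LinearMap.fst F S T) = swappedGraph (0 : T →ₗ[F] S) := by
    ext x
    simp [mem_swappedGraph]
  have h1 := finrank_swappedGraph_inf_swappedGraph φ 0
  rwa [sub_zero, ← h] at h1

/-- The graphs of all codewords of a maximum rank distance code, the swapped graphs of its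
codewords of rank at most `n - 2` and a balanced code fit together: the first family avoids the
second factor, the second one the first factor, and everything else meets these factors in
dimension at least two. -/
theorem IsBalancedCode.exists_extension [Finite F] {n : ℕ} (hn : 2 ≤ n) (hS : finrank F S = n)
    {D : Finset (Submodule F (S × S))} (hD : IsBalancedCode n D) :
    ∃ C : Finset (Submodule F (S × S)), (∀ U ∈ C, finrank F U = n) ∧
      (∀ U ∈ C, ∀ W ∈ C, U ≠ W → finrank F ↥(U ⊓ W) + 2 ≤ n) ∧
      (∃ U ∈ C, ∃ W ∈ C, U ≠ W ∧ finrank F ↥(U ⊓ W) + 2 = n) ∧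
      (C.card : ℚ) = (Nat.card F : ℚ) ^ (n * (n - 1)) +
        (∑ r ∈ Finset.Icc 2 (n - 2), gaussBinom n r (Nat.card F) *
          mrdRangeCount n r (Nat.card F) + 1) + D.card := by
  classical
  obtain ⟨L, hL⟩ := exists_isMRDCode (F := F) (E₁ := S) (E₂ := S) rfl (by omega)
  have := finite_linearMap F S S
  have := Fintype.ofFinite (S →ₗ[F] S)
  have hrank : ∀ φ ∈ L, ∀ ψ ∈ L, φ ≠ ψ → 2 ≤ finrank F (LinearMap.range (φ - ψ)) :=
    fun φ hφ ψ hψ h => hL.two_le_finrank_range (L.sub_mem hφ hψ) (sub_ne_zero.2 h)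
  set A : Finset (Submodule F (S × S)) :=
    (Finset.univ.filter (· ∈ L)).image LinearMap.graph with hA
  set B : Finset (Submodule F (S × S)) :=
    (Finset.univ.filter fun φ : S →ₗ[F] S =>
      φ ∈ L ∧ finrank F (LinearMap.range φ) ≤ n - 2).image swappedGraph with hB
  have hgraph : Function.Injective (LinearMap.graph : (S →ₗ[F] S) → Submodule F (S × S)) := by
    intro φ ψ h
    have h1 := finrank_graph_inf_graph φ ψ
    rw [← h, inf_idem, finrank_graph] at h1
    have h2 : finrank F (LinearMap.range (φ - ψ)) = 0 := by omega
    exact sub_eq_zero.1 (LinearMap.range_eq_bot.1 (Submodule.finrank_eq_zero.1 h2))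
  have hswap : Function.Injective (swappedGraph : (S →ₗ[F] S) → Submodule F (S × S)) := by
    intro φ ψ h
    have h1 := finrank_swappedGraph_inf_swappedGraph φ ψ
    rw [← h, inf_idem, finrank_swappedGraph] at h1
    have h2 : finrank F (LinearMap.range (φ - ψ)) = 0 := by omega
    exact sub_eq_zero.1 (LinearMap.range_eq_bot.1 (Submodule.finrank_eq_zero.1 h2))
  have memA : ∀ U ∈ A, ∃ φ ∈ L, φ.graph = U := by simp [hA]
  have memB : ∀ U ∈ B, ∃ φ : S →ₗ[F] S,
      (φ ∈ L ∧ finrank F (LinearMap.range φ) ≤ n - 2) ∧ swappedGraph φ = U := by simp [hB]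
  have cardA : A.card = Nat.card F ^ (n * (n - 1)) := by
    rw [hA, Finset.card_image_of_injective _ hgraph]
    have h := hL.natCard (by omega)
    rw [hS] at h
    rw [← h, Nat.card_eq_fintype_card]
    exact (Fintype.card_subtype _).symm
  have cardB : (B.card : ℚ) = ∑ r ∈ Finset.Icc 2 (n - 2), gaussBinom n r (Nat.card F) *
      mrdRangeCount n r (Nat.card F) + 1 := by
    rw [hB, Finset.card_image_of_injective _ hswap]
    have h := hL.natCard_finrank_range_le (n - 2)
    rw [hS] at h
    rw [← h, Nat.card_eq_fintype_card, Fintype.card_subtype]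
  have finA : ∀ U ∈ A, finrank F U = n := by
    intro U hU
    obtain ⟨φ, -, rfl⟩ := memA U hU
    rw [finrank_graph, hS]
  have finB : ∀ U ∈ B, finrank F U = n := by
    intro U hU
    obtain ⟨φ, -, rfl⟩ := memB U hU
    rw [finrank_swappedGraph, hS]
  have hBA : ∀ U ∈ B, ∀ W ∈ A, finrank F ↥(U ⊓ W) + 2 ≤ n := by
    intro U hU W hW
    obtain ⟨ψ, hψ, rfl⟩ := memB U hU
    obtain ⟨φ, hφ, rfl⟩ := memA W hW
    rw [← finB _ hU]
    have h := finrank_swappedGraph_inf_ker_fst ψ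
    refine finrank_inf_add_two_le (T := LinearMap.ker (LinearMap.fst F S S)) ?_ ?_
    · have := hψ.2
      omega
    · rw [inf_assoc, inf_comm _ φ.graph, graph_inf_ker_fst, inf_bot_eq]
  have hDA : ∀ U ∈ D, ∀ W ∈ A, finrank F ↥(U ⊓ W) + 2 ≤ n := by
    intro U hU W hW
    obtain ⟨φ, hφ, rfl⟩ := memA W hW
    rw [← hD.finrank_eq _ hU]
    refine finrank_inf_add_two_le (hD.two_le_fst U hU) ?_
    rw [inf_assoc, inf_comm _ φ.graph, graph_inf_ker_fst, inf_bot_eq]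
  have hDB : ∀ U ∈ D, ∀ W ∈ B, finrank F ↥(U ⊓ W) + 2 ≤ n := by
    intro U hU W hW
    obtain ⟨φ, hφ, rfl⟩ := memB W hW
    rw [← hD.finrank_eq _ hU]
    refine finrank_inf_add_two_le (hD.two_le_snd U hU) ?_
    rw [inf_assoc, inf_comm _ (swappedGraph φ), swappedGraph_inf_ker_snd, inf_bot_eq]
  have hAA : ∀ U ∈ A, ∀ W ∈ A, U ≠ W → finrank F ↥(U ⊓ W) + 2 ≤ n := by
    intro U hU W hW hne
    obtain ⟨φ, hφ, rfl⟩ := memA U hU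
    obtain ⟨ψ, hψ, rfl⟩ := memA W hW
    have h1 := hrank φ hφ ψ hψ fun h => hne (by rw [h])
    have h2 := finrank_graph_inf_graph φ ψ
    omega
  have hBB : ∀ U ∈ B, ∀ W ∈ B, U ≠ W → finrank F ↥(U ⊓ W) + 2 ≤ n := by
    intro U hU W hW hne
    obtain ⟨φ, hφ, rfl⟩ := memB U hU
    obtain ⟨ψ, hψ, rfl⟩ := memB W hW
    have h1 := hrank φ hφ.1 ψ hψ.1 fun h => hne (by rw [h])
    have h2 := finrank_swappedGraph_inf_swappedGraph φ ψ
    omega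
  -- two members of different families are distinct, since an `n`-dimensional subspace does not
  -- meet itself in dimension at most `n - 2`
  have hdisj : ∀ {X Y : Finset (Submodule F (S × S))}, (∀ U ∈ X, finrank F U = n) →
      (∀ U ∈ X, ∀ W ∈ Y, finrank F ↥(U ⊓ W) + 2 ≤ n) → Disjoint X Y := by
    intro X Y hX hXY
    rw [Finset.disjoint_left]
    intro U hU hU'
    have := hXY U hU U hU'
    rw [inf_idem, hX U hU] at this
    omega
  refine ⟨D ∪ (B ∪ A), ?_, ?_, ?_, ?_⟩
  · intro U hU
    simp only [Finset.mem_union] at hU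
    rcases hU with hU | hU | hU
    exacts [hD.finrank_eq U hU, finB U hU, finA U hU]
  · intro U hU W hW hne
    simp only [Finset.mem_union] at hU hW
    rcases hU with hU | hU | hU <;> rcases hW with hW | hW | hW
    · exact hD.inf_le U hU W hW hne
    · exact hDB U hU W hW
    · exact hDA U hU W hW
    · rw [inf_comm]; exact hDB W hW U hU
    · exact hBB U hU W hW hne
    · exact hBA U hU W hW
    · rw [inf_comm]; exact hDA W hW U hU
    · rw [inf_comm]; exact hBA W hW U hU
    · exact hAA U hU W hW hne
  · -- a codeword of rank two is at distance four from the zero codeword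
    obtain ⟨X, hX⟩ := exists_submodule_finrank_eq (F := F) (V := S) (r := 2) (by omega)
    have hX0 : X ≠ ⊥ := fun h => by rw [h, finrank_bot] at hX; omega
    have h1 := hL X hX0
    have h2 : 1 < Nat.card {φ : S →ₗ[F] S // φ ∈ L ∧ LinearMap.range φ ≤ X} := by
      rw [h1, hS, hX]
      exact Nat.one_lt_pow (by omega) (two_le_natCard_field F)
    rw [Finite.one_lt_card_iff_nontrivial] at h2
    obtain ⟨φ, hφ⟩ := exists_ne
      (⟨0, L.zero_mem, by simp⟩ : {φ : S →ₗ[F] S // φ ∈ L ∧ LinearMap.range φ ≤ X})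
    have hφ0 : φ.1 ≠ 0 := fun h => hφ (Subtype.ext h)
    have h3 := hL.two_le_finrank_range φ.2.1 hφ0
    have h4 : finrank F (LinearMap.range φ.1) ≤ finrank F X := Submodule.finrank_mono φ.2.2
    have h5 := finrank_graph_inf_graph φ.1 0
    rw [sub_zero] at h5
    refine ⟨φ.1.graph, ?_, (0 : S →ₗ[F] S).graph, ?_, fun h => hφ0 (hgraph h), by omega⟩
    · refine Finset.mem_union_right _ (Finset.mem_union_right _ (Finset.mem_image_of_mem _ ?_))
      simp [φ.2.1]
    · refine Finset.mem_union_right _ (Finset.mem_union_right _ (Finset.mem_image_of_mem _ ?_))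
      simp
  · have d1 : Disjoint B A := hdisj finB hBA
    have d2 : Disjoint D (B ∪ A) := hdisj hD.finrank_eq fun U hU W hW => by
      rcases Finset.mem_union.1 hW with hW | hW
      exacts [hDB U hU W hW, hDA U hU W hW]
    rw [Finset.card_union_of_disjoint d2, Finset.card_union_of_disjoint d1]
    push_cast
    rw [cardA, cardB]
    push_cast
    ring

end Lifting

/-! ### Balanced codes from partial spreads -/

section PartialSpread

variable {F S : Type*} [Field F] [AddCommGroup S] [Module F S]

/-- The subspace of all `(α z, β z + w)` with `w ∈ W`. -/
def twistedSum {Z : Type*} [AddCommGroup Z] [Module F Z] (α β : Z →ₗ[F] S) (W : Submodule F S) :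
    Submodule F (S × S) :=
  LinearMap.range (α.prod β) ⊔ W.map (LinearMap.inr F S S)

section TwistedSum

variable {Z : Type*} [AddCommGroup Z] [Module F Z] {α β : Z →ₗ[F] S} {W : Submodule F S}

lemma mem_twistedSum {x : S × S} :
    x ∈ twistedSum α β W ↔ ∃ z, x.1 = α z ∧ x.2 - β z ∈ W := by
  rw [twistedSum, Submodule.mem_sup]
  constructor
  · rintro ⟨_, ⟨z, rfl⟩, _, ⟨w, hw, rfl⟩, rfl⟩
    exact ⟨z, by simp, by simpa using hw⟩
  · rintro ⟨z, h1, h2⟩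
    refine ⟨_, ⟨z, rfl⟩, _, ⟨_, h2, rfl⟩, ?_⟩
    ext
    · simp [h1]
    · simp

lemma twistedSum_map_fst : (twistedSum α β W).map (LinearMap.fst F S S) = LinearMap.range α := by
  ext x
  simp only [Submodule.mem_map, mem_twistedSum, LinearMap.fst_apply, LinearMap.mem_range]
  constructor
  · rintro ⟨y, ⟨z, h, -⟩, rfl⟩
    exact ⟨z, h.symm⟩
  · rintro ⟨z, rfl⟩
    exact ⟨(α z, β z), ⟨z, rfl, by simp⟩, rfl⟩

lemma twistedSum_inf_ker_fst (hα : Function.Injective α) :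
    twistedSum α β W ⊓ LinearMap.ker (LinearMap.fst F S S) = W.map (LinearMap.inr F S S) := by
  ext ⟨x, y⟩
  simp only [Submodule.mem_inf, mem_twistedSum, LinearMap.mem_ker, LinearMap.fst_apply,
    Submodule.mem_map, LinearMap.inr_apply, Prod.mk.injEq]
  constructor
  · rintro ⟨⟨z, h1, h2⟩, rfl⟩
    have : z = 0 := hα (by rw [← h1, map_zero])
    subst this
    exact ⟨y, by simpa using h2, rfl, rfl⟩
  · rintro ⟨w, hw, rfl, rfl⟩
    exact ⟨⟨0, by simp, by simpa using hw⟩, rfl⟩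

lemma finrank_map_inr (W : Submodule F S) :
    finrank F (W.map (LinearMap.inr F S S)) = finrank F W :=
  (Submodule.equivMapOfInjective _ LinearMap.inr_injective W).finrank_eq.symm

lemma finrank_twistedSum [FiniteDimensional F S] [FiniteDimensional F Z] (hα : Function.Injective α) :
    finrank F (twistedSum α β W) = finrank F Z + finrank F W := by
  rw [← finrank_map_add_finrank_inf_ker (LinearMap.fst F S S), twistedSum_map_fst,
    twistedSum_inf_ker_fst hα, finrank_map_inr, LinearMap.finrank_range_of_inj hα]

end TwistedSum

variable [FiniteDimensional F S]

/-- The annihilators of the members of a partial spread, transported to the space itself. -/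
lemma exists_family_of_partialSpread {Λ : Type*} (W : Λ → Submodule F S)
    (hW : ∀ i, finrank F (W i) = 2) (hW' : ∀ i j, i ≠ j → W i ⊓ W j = ⊥) :
    ∃ Y : Λ → Submodule F S, (∀ i, finrank F (Y i) + 2 = finrank F S) ∧
      ∀ i j, i ≠ j → finrank F ↥(Y i ⊓ Y j) + 4 = finrank F S := by
  let e : Module.Dual F S ≃ₗ[F] S := LinearEquiv.ofFinrankEq _ _ Subspace.dual_finrank_eq
  have h : ∀ X : Submodule F S,
      finrank F (X.dualAnnihilator.map e.toLinearMap) + finrank F X = finrank F S := fun X => by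
    have h1 : finrank F (X.dualAnnihilator.map e.toLinearMap) = finrank F X.dualAnnihilator :=
      LinearEquiv.finrank_map_eq e _
    rw [h1, add_comm]
    exact Subspace.finrank_add_finrank_dualAnnihilator_eq X
  refine ⟨fun i => (W i).dualAnnihilator.map e.toLinearMap, fun i => ?_, fun i j hij => ?_⟩
  · rw [← h (W i), hW]
  · rw [← Submodule.map_inf _ e.injective, ← Submodule.dualAnnihilator_sup_eq, ← h (W i ⊔ W j)]
    have h1 := Submodule.finrank_sup_add_finrank_inf_eq (W i) (W j)
    rw [hW' i j hij, finrank_bot, hW, hW] at h1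
    omega

lemma exists_injective_range_eq {Z : Type*} [AddCommGroup Z] [Module F Z] [FiniteDimensional F Z]
    {X : Submodule F S} (h : finrank F Z = finrank F X) :
    ∃ f : Z →ₗ[F] S, Function.Injective f ∧ LinearMap.range f = X := by
  let e : Z ≃ₗ[F] X := LinearEquiv.ofFinrankEq _ _ h
  refine ⟨X.subtype ∘ₗ e.toLinearMap, X.injective_subtype.comp e.injective, ?_⟩
  rw [LinearMap.range_comp_of_range_eq_top _ e.range, Submodule.range_subtype]

/-- The members `(α_i z, β_j (φ z) + w)`, `w ∈ W_j`, of the code are indexed by two members `i`, `j`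
of a partial spread and a codeword `φ` of small rank. They meet the second factor in `W_j` and
project onto the range `Y_i` of `α_i` in the first one, so that only members with the same `i` and
`j` can intersect in a large subspace, and these are kept apart by the rank distance. -/
theorem exists_isBalancedCode_of_partialSpread [Finite F] {Z : Type*} [AddCommGroup Z] [Module F Z]
    [FiniteDimensional F Z] {n : ℕ} (hn : 4 ≤ n) (hS : finrank F S = n) (hZ : finrank F Z = n - 2)
    {Λ : Type*} [Finite Λ] (W : Λ → Submodule F S)
    (hW : ∀ i, finrank F (W i) = 2) (hW' : ∀ i j, i ≠ j → W i ⊓ W j = ⊥)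
    {L : Submodule F (Z →ₗ[F] Z)} (hL : IsMRDCode L) :
    ∃ D : Finset (Submodule F (S × S)), IsBalancedCode n D ∧ D.card =
      Nat.card Λ ^ 2 *
        Nat.card {φ : Z →ₗ[F] Z // φ ∈ L ∧ finrank F (LinearMap.range φ) ≤ n - 4} := by
  have := finite_linearMap F Z Z
  obtain ⟨Y, hY, hY'⟩ := exists_family_of_partialSpread W hW hW'
  choose α hα hα' using fun i => exists_injective_range_eq (F := F) (Z := Z) (X := Y i)
    (by have := hY i; omega)
  choose Wc hWc using fun i => (W i).exists_isCompl
  have hWcf : ∀ i, finrank F Z = finrank F (Wc i) := fun i => by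
    have := Submodule.finrank_add_eq_of_isCompl (hWc i)
    rw [hW i] at this
    omega
  choose β hβ hβ' using fun i => exists_injective_range_eq (hWcf i)
  let U : Λ × Λ × {φ : Z →ₗ[F] Z // φ ∈ L ∧ finrank F (LinearMap.range φ) ≤ n - 4} →
      Submodule F (S × S) := fun x => twistedSum (α x.1) (β x.2.1 ∘ₗ x.2.2.1) (W x.2.1)
  have hU : ∀ x, finrank F (U x) = n := fun x => by
    change finrank F (twistedSum _ _ _) = n
    rw [finrank_twistedSum (hα _), hW]
    omega
  have hU2 : ∀ x, U x ⊓ LinearMap.ker (LinearMap.fst F S S) =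
      (W x.2.1).map (LinearMap.inr F S S) := fun x => twistedSum_inf_ker_fst (hα _)
  have key : ∃ D : Finset (Submodule F (S × S)), IsBalancedCode n D ∧ D.card = Nat.card
      (Λ × Λ × {φ : Z →ₗ[F] Z // φ ∈ L ∧ finrank F (LinearMap.range φ) ≤ n - 4}) := by
    refine exists_isBalancedCode_card_eq U hU (fun x => ?_) (fun x => ?_) (fun x y hxy => ?_)
    · rw [hU2, finrank_map_inr, hW]
    · have h1 := LinearMap.finrank_range_add_finrank_ker x.2.2.1
      have h2 := x.2.2.2.2
      have h3 : ((LinearMap.ker x.2.2.1).map (LinearMap.inl F S S ∘ₗ α x.1)) ≤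
          U x ⊓ LinearMap.ker (LinearMap.snd F S S) := by
        rintro _ ⟨z, hz, rfl⟩
        refine ⟨mem_twistedSum.2 ⟨z, rfl, ?_⟩, by simp⟩
        have hz : x.2.2.1 z = 0 := hz
        simp [hz]
      have h4 := Submodule.finrank_mono h3
      have h5 := (Submodule.equivMapOfInjective (LinearMap.inl F S S ∘ₗ α x.1)
        (LinearMap.inl_injective.comp (hα x.1)) (LinearMap.ker x.2.2.1)).finrank_eq
      omega
    · obtain ⟨i, j, φ, hφ⟩ := x
      obtain ⟨i', j', ψ, hψ⟩ := y
      rcases eq_or_ne j j' with rfl | hj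
      · have h1 := finrank_map_add_finrank_inf_ker (LinearMap.fst F S S)
          (U (i, j, ⟨φ, hφ⟩) ⊓ U (i', j, ⟨ψ, hψ⟩))
        have h2 : finrank F ↥(U (i, j, ⟨φ, hφ⟩) ⊓ U (i', j, ⟨ψ, hψ⟩) ⊓
            LinearMap.ker (LinearMap.fst F S S)) ≤ 2 := by
          refine (Submodule.finrank_mono (inf_le_inf_right _ inf_le_left)).trans ?_
          rw [hU2, finrank_map_inr, hW]
        rcases eq_or_ne i i' with rfl | hi
        · have hne : φ ≠ ψ := fun h => hxy (by subst h; rfl)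
          have h3 := hL.two_le_finrank_range (L.sub_mem hφ.1 hψ.1) (sub_ne_zero.2 hne)
          have h4 := LinearMap.finrank_range_add_finrank_ker (φ - ψ)
          have h5 : (U (i, j, ⟨φ, hφ⟩) ⊓ U (i, j, ⟨ψ, hψ⟩)).map (LinearMap.fst F S S) ≤
              (LinearMap.ker (φ - ψ)).map (α i) := by
            rintro _ ⟨v, ⟨hv, hv'⟩, rfl⟩
            obtain ⟨z, hz, hzW⟩ := mem_twistedSum.1 hv
            obtain ⟨z', hz', hzW'⟩ := mem_twistedSum.1 hv'
            obtain rfl : z = z' := hα i (hz.symm.trans hz')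
            refine ⟨z, ?_, hz.symm⟩
            -- the difference of the second components lies in `W_j` and in its complement
            have h6 : β j ((φ - ψ) z) ∈ W j := by
              have := (W j).sub_mem hzW' hzW
              simpa using this
            have h7 : β j ((φ - ψ) z) ∈ Wc j := by
              rw [← hβ' j]
              exact ⟨_, rfl⟩
            have h8 := (Submodule.disjoint_def.1 (hWc j).disjoint) _ h6 h7
            exact hβ j (by rw [h8, map_zero])
          have h6 := Submodule.finrank_mono h5
          have h7 := (Submodule.equivMapOfInjective (α i) (hα i) (LinearMap.ker (φ - ψ))).finrank_eq
          omega
        · have h3 := hY' i i' hi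
          have h4 : (U (i, j, ⟨φ, hφ⟩) ⊓ U (i', j, ⟨ψ, hψ⟩)).map (LinearMap.fst F S S) ≤
              Y i ⊓ Y i' := by
            refine (Submodule.map_inf_le _).trans (le_of_eq ?_)
            change Submodule.map _ (twistedSum _ _ _) ⊓ Submodule.map _ (twistedSum _ _ _) = _
            rw [twistedSum_map_fst, twistedSum_map_fst, hα', hα']
          have h5 := Submodule.finrank_mono h4
          omega
      · refine le_of_le_of_eq (finrank_inf_add_two_le (T := LinearMap.ker (LinearMap.fst F S S))
          ?_ ?_) (hU _)
        · rw [hU2, finrank_map_inr, hW]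
        · have h1 : U (i, j, ⟨φ, hφ⟩) ⊓ LinearMap.ker (LinearMap.fst F S S) ⊓ U (i', j', ⟨ψ, hψ⟩) =
              (U (i, j, ⟨φ, hφ⟩) ⊓ LinearMap.ker (LinearMap.fst F S S)) ⊓
                (U (i', j', ⟨ψ, hψ⟩) ⊓ LinearMap.ker (LinearMap.fst F S S)) := by
            ext v
            simp only [Submodule.mem_inf]
            tauto
          rw [h1, hU2, hU2, ← Submodule.map_inf _ LinearMap.inr_injective, hW' j j' hj,
            Submodule.map_bot]
  obtain ⟨D, hD, hcard⟩ := key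
  refine ⟨D, hD, ?_⟩
  rw [hcard, Nat.card_prod, Nat.card_prod]
  ring

end PartialSpread

/-! ### The Desarguesian line spread -/

section LineSpread

variable {F K S : Type*} [Field F] [Field K] [Algebra F K] [AddCommGroup S] [Module F S]
  [Module K S] [IsScalarTower F K S]

lemma finrank_restrictScalars (L : Submodule K S) :
    finrank F (L.restrictScalars F) = finrank F K * finrank K L :=
  (Module.finrank_mul_finrank F K L).symm

lemma restrictScalars_inf_eq_bot {L L' : Submodule K S} [FiniteDimensional K S]
    (hL : finrank K L = 1) (hL' : finrank K L' = 1) (h : L ≠ L') :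
    L.restrictScalars F ⊓ L'.restrictScalars F = ⊥ := by
  have h1 : L ⊓ L' = ⊥ := by
    by_contra hne
    have h2 : 1 ≤ finrank K ↥(L ⊓ L') := Submodule.one_le_finrank_iff.2 hne
    have h3 := Submodule.eq_of_le_of_finrank_le (inf_le_left : L ⊓ L' ≤ L) (by omega)
    have h4 := Submodule.eq_of_le_of_finrank_le (inf_le_right : L ⊓ L' ≤ L') (by omega)
    exact h (h3.symm.trans h4)
  rw [eq_bot_iff]
  intro x hx
  have h2 : x ∈ L ⊓ L' := hx
  rw [h1] at h2
  exact h2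

/-- A subspace of dimension two over `F` that contains a nonzero vector together with a multiple of
it by some `μ ∈ K` outside `F` is a line over `K`. -/
lemma exists_restrictScalars_eq_of_smul_mem [FiniteDimensional F K] [FiniteDimensional F S]
    (hK : finrank F K = 2) {W : Submodule F S}
    (hW : finrank F W = 2) {y : S} (hy0 : y ≠ 0) (hy : y ∈ W) {μ : K} (hμy : μ • y ∈ W)
    (hμ : μ ∉ Set.range (algebraMap F K)) :
    ∃ L : Submodule K S, finrank K L = 1 ∧ L.restrictScalars F = W := by
  have hL : finrank K (Submodule.span K {y}) = 1 := finrank_span_singleton hy0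
  refine ⟨Submodule.span K {y}, hL, ?_⟩
  let P : Submodule F K := W.comap ((LinearMap.toSpanSingleton K S y).restrictScalars F)
  have hlt : Submodule.span F {(1 : K)} < P := by
    refine lt_of_le_of_ne ?_ fun h => ?_
    · rw [Submodule.span_singleton_le_iff_mem]
      change (1 : K) • y ∈ W
      rwa [one_smul]
    · have h1 : μ ∈ P := hμy
      rw [← h, Submodule.mem_span_singleton] at h1
      obtain ⟨c, rfl⟩ := h1
      exact hμ ⟨c, Algebra.algebraMap_eq_smul_one c⟩
  have h1 := Submodule.finrank_lt_finrank_of_lt hlt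
  rw [finrank_span_singleton one_ne_zero] at h1
  have h2 : P = ⊤ := Submodule.eq_top_of_finrank_eq
    (le_antisymm (Submodule.finrank_le P) (by omega))
  refine Submodule.eq_of_le_of_finrank_eq (fun x hx => ?_) ?_
  · obtain ⟨k, rfl⟩ := Submodule.mem_span_singleton.1 hx
    have : k ∈ P := h2 ▸ Submodule.mem_top
    exact this
  · rw [finrank_restrictScalars, hL, hK, hW]

lemma exists_notMem_range_algebraMap (hK : finrank F K = 2) :
    ∃ θ : K, θ ∉ Set.range (algebraMap F K) := by
  by_contra! h
  have h1 : (⊥ : Subalgebra F K) = ⊤ :=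
    eq_top_iff.2 fun x _ => Algebra.mem_bot.2 (h x)
  have h2 := Subalgebra.bot_eq_top_iff_finrank_eq_one.1 h1
  omega

/-- Representatives of the `q + 1` cosets of `Fˣ` in `Kˣ`, for a quadratic extension `K` of the
field `F` with `q` elements, in terms of a generator `θ`. -/
def cosetRep (θ : K) : Option F → K
  | none => 1
  | some c => θ + algebraMap F K c

lemma cosetRep_ne_zero {θ : K} (hθ : θ ∉ Set.range (algebraMap F K)) (o : Option F) :
    cosetRep θ o ≠ 0 := by
  cases o with
  | none => exact one_ne_zero
  | some c =>
    intro h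
    exact hθ ⟨-c, by rw [map_neg]; exact (eq_neg_of_add_eq_zero_left h).symm⟩

lemma inv_mul_cosetRep_notMem {θ : K} (hθ : θ ∉ Set.range (algebraMap F K)) {o o' : Option F}
    (h : o ≠ o') : (cosetRep θ o)⁻¹ * cosetRep θ o' ∉ Set.range (algebraMap F K) := by
  rintro ⟨a, ha⟩
  rw [eq_inv_mul_iff_mul_eq₀ (cosetRep_ne_zero hθ o)] at ha
  cases o with
  | none =>
    cases o' with
    | none => exact h rfl
    | some c =>
      simp only [cosetRep, one_mul] at ha
      exact hθ ⟨a - c, by rw [map_sub, ha, add_sub_cancel_right]⟩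
  | some c =>
    cases o' with
    | none =>
      simp only [cosetRep] at ha
      have ha0 : algebraMap F K a ≠ 0 := fun h0 => by simp [h0] at ha
      refine hθ ⟨a⁻¹ - c, ?_⟩
      rw [map_sub, map_inv₀, sub_eq_iff_eq_add]
      exact (eq_inv_of_mul_eq_one_left ha).symm
    | some c' =>
      simp only [cosetRep] at ha
      rcases eq_or_ne a 1 with rfl | ha1
      · rw [map_one, mul_one, add_right_inj] at ha
        exact h (by rw [(algebraMap F K).injective ha])
      · have h1 : algebraMap F K (a - 1) ≠ 0 := by
          rw [Ne, map_eq_zero]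
          exact sub_ne_zero.2 ha1
        refine hθ ⟨(c' - c * a) / (a - 1), ?_⟩
        rw [map_div₀, div_eq_iff h1]
        simp only [map_sub, map_mul, map_one]
        linear_combination -ha

lemma prod_inf_ker_fst (p q : Submodule F S) :
    p.prod q ⊓ LinearMap.ker (LinearMap.fst F S S) = q.map (LinearMap.inr F S S) := by
  ext ⟨x, y⟩
  simp only [Submodule.mem_inf, Submodule.mem_prod, LinearMap.mem_ker, LinearMap.fst_apply,
    Submodule.mem_map, LinearMap.inr_apply, Prod.mk.injEq]
  constructor
  · rintro ⟨⟨-, h⟩, rfl⟩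
    exact ⟨y, h, rfl, rfl⟩
  · rintro ⟨_, h, rfl, rfl⟩
    exact ⟨⟨p.zero_mem, h⟩, rfl⟩

lemma finrank_submodule_prod [FiniteDimensional F S] (p q : Submodule F S) :
    finrank F (p.prod q) = finrank F p + finrank F q := by
  rw [← finrank_map_add_finrank_inf_ker (LinearMap.fst F S S), Submodule.prod_map_fst,
    prod_inf_ker_fst, finrank_map_inr]

lemma le_finrank_prod_inf_ker_snd [FiniteDimensional F S] (p q : Submodule F S) :
    finrank F p ≤ finrank F ↥(p.prod q ⊓ LinearMap.ker (LinearMap.snd F S S)) := by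
  rw [(Submodule.equivMapOfInjective (LinearMap.inl F S S) LinearMap.inl_injective p).finrank_eq]
  refine Submodule.finrank_mono ?_
  rintro _ ⟨x, hx, rfl⟩
  exact ⟨⟨hx, q.zero_mem⟩, rfl⟩

/-- In dimension four, pairs of two-dimensional subspaces such that two pairs with a common
component have disjoint other components give a balanced code. -/
lemma exists_isBalancedCode_of_pairs [FiniteDimensional F S] {ι : Type*} [Finite ι]
    (p q : ι → Submodule F S) (hp : ∀ i, finrank F (p i) = 2) (hq : ∀ i, finrank F (q i) = 2)
    (h1 : ∀ i j, i ≠ j → p i = p j → q i ⊓ q j = ⊥)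
    (h2 : ∀ i j, i ≠ j → q i = q j → p i ⊓ p j = ⊥) :
    ∃ D : Finset (Submodule F (S × S)), IsBalancedCode 4 D ∧ D.card = Nat.card ι := by
  have hlt : ∀ W W' : Submodule F S, finrank F W = 2 → finrank F W' = 2 → W ≠ W' →
      finrank F ↥(W ⊓ W') ≤ 1 := by
    intro W W' hW hW' hne
    by_contra! h
    exact hne ((Submodule.eq_of_le_of_finrank_le (inf_le_left : W ⊓ W' ≤ W) (by omega)).symm.trans
      (Submodule.eq_of_le_of_finrank_le (inf_le_right : W ⊓ W' ≤ W') (by omega)))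
  refine exists_isBalancedCode_card_eq (fun i => (p i).prod (q i)) (fun i => ?_) (fun i => ?_)
    (fun i => ?_) (fun i j hij => ?_)
  · rw [finrank_submodule_prod, hp, hq]
  · rw [prod_inf_ker_fst, finrank_map_inr, hq]
  · rw [← hp i]
    exact le_finrank_prod_inf_ker_snd _ _
  · rw [Submodule.prod_inf_prod, finrank_submodule_prod]
    rcases eq_or_ne (p i) (p j) with hpij | hpij
    · rw [h1 i j hij hpij, finrank_bot, hpij, inf_idem, hp]
    · rcases eq_or_ne (q i) (q j) with hqij | hqij
      · rw [h2 i j hij hqij, finrank_bot, hqij, inf_idem, hq]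
      · have e1 := hlt _ _ (hp i) (hp j) hpij
        have e2 := hlt _ _ (hq i) (hq j) hqij
        omega

/-- The index set consists of the pairs of `K`-lines, and of the pairs `(W, λ W)` where `W` has
dimension two over `F` without being a `K`-line and `λ` runs through representatives of
`Kˣ / Fˣ`. Distinct multiples `λ W`, `λ' W` are disjoint: otherwise `W` contains some `y ≠ 0` along
with a multiple of it by an element of `K` outside `F`, and is a `K`-line. -/
theorem exists_isBalancedCode_of_quadratic_extension [Finite F] [FiniteDimensional F K]
    [FiniteDimensional F S] (hK : finrank F K = 2) (hS : finrank K S = 2) :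
    ∃ D : Finset (Submodule F (S × S)), IsBalancedCode 4 D ∧
      D.card = ((Nat.card F ^ 2 + 1) *
        (Nat.card F ^ 3 + 3 * Nat.card F ^ 2 + Nat.card F + 1)) := by
  have := finite_submodule F S
  have : Finite K := Module.finite_of_finite F
  have : FiniteDimensional K S := FiniteDimensional.of_finrank_pos (by omega)
  have := finite_submodule K S
  have hFS : finrank F S = 4 := by rw [← Module.finrank_mul_finrank F K S, hK, hS]
  obtain ⟨θ, hθ⟩ := exists_notMem_range_algebraMap hK
  let IsLine : Submodule F S → Prop := fun W =>
    ∃ L : Submodule K S, finrank K L = 1 ∧ L.restrictScalars F = W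
  let Λ := {L : Submodule K S // finrank K L = 1}
  let N := {W : Submodule F S // finrank F W = 2 ∧ ¬ IsLine W}
  let m : K → S →ₗ[F] S := fun k => Algebra.lsmul F F S k
  have hm : ∀ o : Option F, Function.Injective (m (cosetRep θ o)) := fun o x y h =>
    smul_right_injective S (cosetRep_ne_zero hθ o) h
  have hdisj : ∀ W : N, ∀ y ∈ W.1, ∀ o o' : Option F, o ≠ o' →
      ((cosetRep θ o)⁻¹ * cosetRep θ o') • y ∈ W.1 → y = 0 := by
    intro W y hy o o' ho hmem
    by_contra hy0
    exact W.2.2 (exists_restrictScalars_eq_of_smul_mem hK W.2.1 hy0 hy hmem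
      (inv_mul_cosetRep_notMem hθ ho))
  have hline : ∀ (L : Λ) (W : N) (o : Option F),
      L.1.restrictScalars F ≠ W.1.map (m (cosetRep θ o)) := by
    intro L W o h
    refine W.2.2 ⟨L.1, L.2, ?_⟩
    have hfin : finrank F (L.1.restrictScalars F) = finrank F W.1 := by
      rw [finrank_restrictScalars, hK, L.2, W.2.1]
    refine (Submodule.eq_of_le_of_finrank_eq (fun x hx => ?_) hfin.symm).symm
    have h1 : m (cosetRep θ o) x ∈ L.1.restrictScalars F := h ▸ ⟨x, hx, rfl⟩
    exact (L.1.smul_mem_iff (cosetRep_ne_zero hθ o)).1 h1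
  have key : ∃ D : Finset (Submodule F (S × S)), IsBalancedCode 4 D ∧
      D.card = Nat.card ((Λ × Λ) ⊕ (N × Option F)) := by
    refine exists_isBalancedCode_of_pairs
      (Sum.elim (fun x => x.1.1.restrictScalars F) fun x => x.1.1)
      (Sum.elim (fun x => x.2.1.restrictScalars F) fun x => x.1.1.map (m (cosetRep θ x.2)))
      ?_ ?_ ?_ ?_
    · rintro (x | x)
      · exact (finrank_restrictScalars _).trans (by rw [hK, x.1.2])
      · exact x.1.2.1
    · rintro (x | x)
      · exact (finrank_restrictScalars _).trans (by rw [hK, x.2.2])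
      · exact ((Submodule.equivMapOfInjective _ (hm _) _).finrank_eq).symm.trans x.1.2.1
    · rintro (⟨L, M⟩ | ⟨W, o⟩) (⟨L', M'⟩ | ⟨W', o'⟩) hne h
      · obtain rfl : L = L' := Subtype.ext (Submodule.restrictScalars_injective F K S h)
        exact restrictScalars_inf_eq_bot M.2 M'.2 fun h =>
          hne (congr_arg (fun x => Sum.inl (L, x)) (Subtype.ext h))
      · exact absurd ⟨L.1, L.2, h⟩ W'.2.2
      · exact absurd ⟨L'.1, L'.2, h.symm⟩ W.2.2
      · obtain rfl : W = W' := Subtype.ext h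
        have ho : o ≠ o' := fun h => hne (by rw [h])
        rw [eq_bot_iff]
        rintro _ ⟨⟨x, hx, rfl⟩, ⟨y, hy, hxy⟩⟩
        have hxy : cosetRep θ o' • y = cosetRep θ o • x := hxy
        have h1 : ((cosetRep θ o)⁻¹ * cosetRep θ o') • y = x := by
          rw [mul_smul, hxy, inv_smul_smul₀ (cosetRep_ne_zero hθ o)]
        have hy0 := hdisj W y hy o o' ho (h1 ▸ hx)
        have hx0 : x = 0 := by rw [← h1, hy0, smul_zero]
        simp [hx0]
    · rintro (⟨L, M⟩ | ⟨W, o⟩) (⟨L', M'⟩ | ⟨W', o'⟩) hne h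
      · obtain rfl : M = M' := Subtype.ext (Submodule.restrictScalars_injective F K S h)
        exact restrictScalars_inf_eq_bot L.2 L'.2 fun h =>
          hne (congr_arg (fun x => Sum.inl (x, M)) (Subtype.ext h))
      · exact absurd h (hline M W' o')
      · exact absurd h.symm (hline M' W o)
      · have h : W.1.map (m (cosetRep θ o)) = W'.1.map (m (cosetRep θ o')) := h
        have ho : o ≠ o' := by
          rintro rfl
          exact hne (by rw [Subtype.ext (Submodule.map_injective_of_injective (hm o) h)])
        rw [eq_bot_iff]
        rintro z ⟨hz, hz'⟩
        have h1 : m (cosetRep θ o') z ∈ W.1.map (m (cosetRep θ o)) := h ▸ ⟨z, hz', rfl⟩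
        obtain ⟨y, hy, hyz⟩ := h1
        have hyz : cosetRep θ o • y = cosetRep θ o' • z := hyz
        have h2 : ((cosetRep θ o)⁻¹ * cosetRep θ o') • z = y := by
          rw [mul_smul, ← hyz, inv_smul_smul₀ (cosetRep_ne_zero hθ o)]
        exact hdisj W z hz o o' ho (h2 ▸ hy)
  obtain ⟨D, hD, hcard⟩ := key
  refine ⟨D, hD, ?_⟩
  have hq := two_le_natCard_field F
  have hKc : Nat.card K = Nat.card F ^ 2 := by
    rw [Module.natCard_eq_pow_finrank (K := F) (V := K), hK]
  have cΛ : Nat.card Λ = Nat.card F ^ 2 + 1 := by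
    have h := natCard_submodule_finrank_eq (F := K) (V := S) 1
    rw [hS, hKc] at h
    have h1 := natCast_pow_sub_one_ne_zero hq two_ne_zero
    have h2 : gaussBinom 2 1 (Nat.card F ^ 2) = ((Nat.card F ^ 2 + 1 : ℕ) : ℚ) := by
      simp only [gaussBinom, Finset.prod_range_one, Nat.sub_zero, zero_add, pow_one]
      push_cast
      rw [div_eq_iff h1]
      ring
    rw [h2] at h
    exact_mod_cast h
  have cN : Nat.card N + Nat.card Λ =
      (Nat.card F ^ 2 + 1) * (Nat.card F ^ 2 + Nat.card F + 1) := by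
    have h := natCard_submodule_finrank_eq (F := F) (V := S) 2
    have h2 : gaussBinom 4 2 (Nat.card F) =
        (((Nat.card F ^ 2 + 1) * (Nat.card F ^ 2 + Nat.card F + 1) : ℕ) : ℚ) := by
      have h1 := natCast_pow_sub_one_ne_zero hq two_ne_zero
      have h1' := natCast_pow_sub_one_ne_zero hq one_ne_zero
      simp only [gaussBinom, Finset.prod_range_succ, Finset.prod_range_zero, Nat.sub_zero,
        zero_add, one_mul]
      push_cast
      rw [div_eq_iff (mul_ne_zero h1' h1)]
      ring
    rw [hFS, h2] at h
    have h3 : Nat.card {W : Submodule F S // finrank F W = 2} =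
          (Nat.card F ^ 2 + 1) * (Nat.card F ^ 2 + Nat.card F + 1) := by exact_mod_cast h
    rw [← h3, add_comm]
    have e : Nat.card Λ = Nat.card {W : Submodule F S // finrank F W = 2 ∧ IsLine W} := by
      refine Nat.card_eq_of_bijective (fun L => ⟨L.1.restrictScalars F,
        by rw [finrank_restrictScalars, hK, L.2], L.1, L.2, rfl⟩) ⟨fun L L' h => ?_, ?_⟩
      · exact Subtype.ext (Submodule.restrictScalars_injective F K S (congr_arg Subtype.val h))
      · rintro ⟨W, hW, L, hL, rfl⟩
        exact ⟨⟨L, hL⟩, rfl⟩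
    classical
    have := Fintype.ofFinite (Submodule F S)
    rw [e]
    simp only [Nat.card_eq_fintype_card, N, Fintype.card_subtype]
    rw [← Finset.filter_filter, ← Finset.filter_filter, Finset.card_filter_add_card_filter_not]
  have cO : Nat.card (Option F) = Nat.card F + 1 := by
    have := Fintype.ofFinite F
    rw [Nat.card_eq_fintype_card, Fintype.card_option, Nat.card_eq_fintype_card]
  rw [hcard, Nat.card_sum, Nat.card_prod, Nat.card_prod, cO]
  rw [cΛ] at cN ⊢
  have cN' : Nat.card N = (Nat.card F ^ 2 + 1) * (Nat.card F ^ 2 + Nat.card F) := by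
    rw [mul_add, mul_one] at cN
    exact Nat.add_right_cancel cN
  rw [cN']
  ring

end LineSpread

/-! ### The number of additional subspaces -/

/-- The part of the cardinality formula that is to be supplied by the balanced code. -/
def balancedCount (n q : ℕ) : ℚ :=
  ((q : ℚ) + 1) * (∏ i ∈ Finset.Icc 1 (n - 1), ((q : ℚ) ^ i + 1)
      + (q : ℚ) ^ (n * (n - 2) / 4) * ∏ i ∈ Finset.Icc 0 ((n - 2) / 2), ((q : ℚ) ^ (2 * i + 1) - 1))
    - 2 * ((q : ℚ) + 1) * (q : ℚ) ^ (n * (n - 1) / 2)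
    - (q : ℚ) * ∑ r ∈ Finset.Icc 1 ((n - 2) / 2), gaussBinom (n / 2) r (q ^ 2)
    + gaussBinom (n / 2) 1 (q ^ 2) * (gaussBinom (n / 2) 1 (q ^ 2) - 1)

lemma two_le_sq {q : ℕ} (hq : 2 ≤ q) : 2 ≤ q ^ 2 := by nlinarith

lemma exists_intCast_eq_balancedCount {q : ℕ} (hq : 2 ≤ q) (n : ℕ) :
    ∃ z : ℤ, (z : ℚ) = balancedCount n q := by
  choose g hg using exists_natCast_eq_gaussBinom (two_le_sq hq)
  refine ⟨((q : ℤ) + 1) * (∏ i ∈ Finset.Icc 1 (n - 1), ((q : ℤ) ^ i + 1)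
      + (q : ℤ) ^ (n * (n - 2) / 4) * ∏ i ∈ Finset.Icc 0 ((n - 2) / 2), ((q : ℤ) ^ (2 * i + 1) - 1))
    - 2 * ((q : ℤ) + 1) * (q : ℤ) ^ (n * (n - 1) / 2)
    - (q : ℤ) * ∑ r ∈ Finset.Icc 1 ((n - 2) / 2), (g (n / 2) r : ℤ)
    + (g (n / 2) 1 : ℤ) * ((g (n / 2) 1 : ℤ) - 1), ?_⟩
  simp only [balancedCount, ← hg]
  push_cast
  rfl

lemma balancedCount_four {q : ℕ} (hq : 2 ≤ q) :
    balancedCount 4 q = ((q : ℚ) ^ 2 + 1) * ((q : ℚ) ^ 3 + 3 * (q : ℚ) ^ 2 + q + 1) := by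
  have h1 := natCast_pow_sub_one_ne_zero hq two_ne_zero
  have h2 : gaussBinom 2 1 (q ^ 2) = (q : ℚ) ^ 2 + 1 := by
    simp only [gaussBinom, Finset.prod_range_one, Nat.sub_zero, zero_add, pow_one]
    push_cast
    rw [div_eq_iff h1]
    ring
  rw [balancedCount]
  norm_num [Finset.prod_Icc_succ_top, h2]
  ring

lemma balancedCount_six_le {q : ℕ} (hq : 2 ≤ q) :
    balancedCount 6 q ≤
      gaussBinom 3 1 (q ^ 2) ^ 2 * (gaussBinom 4 2 q * ((q : ℚ) ^ 4 - 1)) := by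
  have h1 := natCast_pow_sub_one_ne_zero hq two_ne_zero
  have h1' := natCast_pow_sub_one_ne_zero hq one_ne_zero
  have h2 : gaussBinom 3 1 (q ^ 2) = (q : ℚ) ^ 4 + (q : ℚ) ^ 2 + 1 := by
    simp only [gaussBinom, Finset.prod_range_one, Nat.sub_zero, zero_add, pow_one]
    push_cast
    rw [div_eq_iff h1]
    ring
  have h3 : gaussBinom 4 2 q = ((q : ℚ) ^ 2 + 1) * ((q : ℚ) ^ 2 + q + 1) := by
    simp only [gaussBinom, Finset.prod_range_succ, Finset.prod_range_zero, Nat.sub_zero,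
      zero_add, one_mul]
    rw [div_eq_iff (mul_ne_zero h1' h1)]
    ring
  have h4 : 0 ≤ (q : ℚ) * ∑ r ∈ Finset.Icc 1 2, gaussBinom 3 r (q ^ 2) :=
    mul_nonneg (by positivity)
      (Finset.sum_nonneg fun r _ => gaussBinom_nonneg (two_le_sq hq) 3 r)
  rw [h3, balancedCount]
  norm_num [Finset.prod_Icc_succ_top] at h4 ⊢
  rw [h2]
  obtain ⟨t, rfl⟩ := Nat.exists_eq_add_of_le hq
  push_cast
  set x : ℚ := (t : ℚ) with hx
  have hx0 : 0 ≤ x := by positivity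
  -- without the nonpositive term `h4`, the difference of the two sides is a polynomial in
  -- `x = q - 2` with nonnegative coefficients
  refine le_of_sub_nonneg ?_
  have key : 0 ≤ ((2 + x) ^ 4 + (2 + x) ^ 2 + 1) ^ 2 *
      (((2 + x) ^ 2 + 1) * ((2 + x) ^ 2 + (2 + x) + 1) * ((2 + x) ^ 4 - 1)) -
      ((2 + x + 1) * ((2 + x + 1) * ((2 + x) ^ 2 + 1) * ((2 + x) ^ 3 + 1) * ((2 + x) ^ 4 + 1) *
        ((2 + x) ^ 5 + 1) + (2 + x) ^ 6 * ((2 + x - 1) * ((2 + x) ^ 3 - 1) * ((2 + x) ^ 5 - 1))) -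
      2 * (2 + x + 1) * (2 + x) ^ 15 +
      ((2 + x) ^ 4 + (2 + x) ^ 2 + 1) * ((2 + x) ^ 4 + (2 + x) ^ 2)) := by
    ring_nf
    positivity
  push_cast at h4
  linarith

lemma gaussBinom_le_pow {q : ℕ} (hq : 2 ≤ q) (n r : ℕ) : gaussBinom n r q ≤ (q : ℚ) ^ (n * r) := by
  have hq' : (1 : ℚ) ≤ q := by exact_mod_cast (by omega : 1 ≤ q)
  rw [gaussBinom, ← Finset.prod_div_distrib]
  have h : ∀ i ∈ Finset.range r, ((q : ℚ) ^ (n - i) - 1) / ((q : ℚ) ^ (i + 1) - 1) ≤ (q : ℚ) ^ n := by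
    intro i _
    have h1 : (2 : ℚ) ≤ (q : ℚ) ^ (i + 1) := by
      exact_mod_cast hq.trans (Nat.le_self_pow (Nat.succ_ne_zero i) q)
    have h2 : (q : ℚ) ^ (n - i) ≤ (q : ℚ) ^ n := pow_le_pow_right₀ hq' (Nat.sub_le n i)
    have h3 : (0 : ℚ) ≤ (q : ℚ) ^ n := by positivity
    rw [div_le_iff₀ (by linarith)]
    nlinarith
  refine (Finset.prod_le_prod (fun i _ => ?_) h).trans (le_of_eq ?_)
  · exact div_nonneg (sub_nonneg.2 (one_le_pow₀ hq')) (sub_nonneg.2 (one_le_pow₀ hq'))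
  · rw [Finset.prod_const, Finset.card_range, pow_mul]

lemma prod_Icc_pow_add_one_le {x : ℚ} (hx : 2 ≤ x) {k : ℕ} (hk : 2 ≤ k) :
    ∏ i ∈ Finset.Icc 1 k, (x ^ i + 1) ≤ 5 / 2 * (1 - (1 / 2) ^ k) * x ^ (k * (k + 1) / 2) := by
  induction k, hk using Nat.le_induction with
  | base =>
    norm_num [Finset.prod_Icc_succ_top]
    nlinarith [mul_nonneg (sub_nonneg.2 hx) (sub_nonneg.2 hx), sq_nonneg x,
      mul_nonneg (sub_nonneg.2 hx) (sq_nonneg x)]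
  | succ k hk ih =>
    have e : (k + 1) * (k + 1 + 1) / 2 = k * (k + 1) / 2 + (k + 1) := by
      rw [show (k + 1) * (k + 1 + 1) = k * (k + 1) + (k + 1) * 2 by ring,
        Nat.add_mul_div_right _ _ two_pos]
    rw [Finset.prod_Icc_succ_top (by omega), e, pow_add x (k * (k + 1) / 2)]
    have h1 : x ^ (k + 1) + 1 ≤ x ^ (k + 1) * (1 + (1 / 2) ^ (k + 1)) := by
      have : 1 ≤ (x * (1 / 2)) ^ (k + 1) := one_le_pow₀ (by linarith)
      rw [mul_pow] at this
      linarith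
    have h2 : (0 : ℚ) ≤ x ^ (k + 1) := by positivity
    have h3 : (0 : ℚ) ≤ x ^ (k * (k + 1) / 2) := by positivity
    have h4 : (0 : ℚ) < (1 / 2 : ℚ) ^ k := by positivity
    have h5 : (1 / 2 : ℚ) ^ k ≤ 1 := pow_le_one₀ (by norm_num) (by norm_num)
    refine (mul_le_mul ih h1 (by positivity) ?_).trans ?_
    · exact mul_nonneg (mul_nonneg (by norm_num) (by linarith)) h3
    · have h6 : (1 - (1 / 2 : ℚ) ^ k) * (1 + (1 / 2) ^ (k + 1)) ≤ 1 - (1 / 2) ^ (k + 1) := by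
        rw [pow_succ]
        nlinarith
      have h7 : 0 ≤ x ^ (k * (k + 1) / 2) * x ^ (k + 1) := mul_nonneg h3 h2
      have h8 := mul_le_mul_of_nonneg_left h6 h7
      linarith

lemma pow_le_prod_Icc_pow_add_one {x : ℚ} (hx : 0 ≤ x) (k : ℕ) :
    x ^ (k * (k + 1) / 2) ≤ ∏ i ∈ Finset.Icc 1 k, (x ^ i + 1) := by
  induction k with
  | zero => simp
  | succ k ih =>
    have e : (k + 1) * (k + 1 + 1) / 2 = k * (k + 1) / 2 + (k + 1) := by
      rw [show (k + 1) * (k + 1 + 1) = k * (k + 1) + (k + 1) * 2 by ring,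
        Nat.add_mul_div_right _ _ two_pos]
    rw [Finset.prod_Icc_succ_top (by omega), e, pow_add x (k * (k + 1) / 2)]
    exact mul_le_mul ih (by linarith) (by positivity) (Finset.prod_nonneg fun i _ => by positivity)

lemma prod_range_pow_odd_sub_one_nonneg {x : ℚ} (hx : 1 ≤ x) (m : ℕ) :
    0 ≤ ∏ i ∈ Finset.range m, (x ^ (2 * i + 1) - 1) :=
  Finset.prod_nonneg fun _ _ => sub_nonneg.2 (one_le_pow₀ hx)

lemma prod_range_pow_odd_sub_one_le {x : ℚ} (hx : 1 ≤ x) (m : ℕ) :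
    ∏ i ∈ Finset.range m, (x ^ (2 * i + 1) - 1) ≤ x ^ (m * m) := by
  induction m with
  | zero => simp
  | succ m ih =>
    rw [Finset.prod_range_succ, show (m + 1) * (m + 1) = m * m + (2 * m + 1) by ring,
      pow_add x (m * m)]
    exact mul_le_mul ih (by linarith) (sub_nonneg.2 (one_le_pow₀ hx)) (by positivity)

/-- The formula with its exponents and ranges expressed through `m = n / 2`. -/
lemma balancedCount_two_mul {m : ℕ} (hm : 1 ≤ m) (q : ℕ) :
    balancedCount (2 * m) q =
      ((q : ℚ) + 1) * (∏ i ∈ Finset.Icc 1 (2 * m - 1), ((q : ℚ) ^ i + 1)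
        + (q : ℚ) ^ (m * (m - 1)) * ∏ i ∈ Finset.range m, ((q : ℚ) ^ (2 * i + 1) - 1))
      - 2 * ((q : ℚ) + 1) * (q : ℚ) ^ (m * (2 * m - 1))
      - (q : ℚ) * ∑ r ∈ Finset.Icc 1 (m - 1), gaussBinom m r (q ^ 2)
      + gaussBinom m 1 (q ^ 2) * (gaussBinom m 1 (q ^ 2) - 1) := by
  have e1 : 2 * m * (2 * m - 2) / 4 = m * (m - 1) := by
    rw [show 2 * m * (2 * m - 2) = m * (m - 1) * 4 by
      rw [show 2 * m - 2 = 2 * (m - 1) by omega]; ring]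
    exact Nat.mul_div_cancel _ (by norm_num)
  have e2 : (2 * m - 2) / 2 = m - 1 := by omega
  have e3 : 2 * m * (2 * m - 1) / 2 = m * (2 * m - 1) := by
    rw [mul_assoc]
    exact Nat.mul_div_cancel_left _ two_pos
  have e4 : 2 * m / 2 = m := by omega
  have e5 : Finset.Icc 0 (m - 1) = Finset.range m := by
    ext i
    simp only [Finset.mem_Icc, Finset.mem_range]
    omega
  rw [balancedCount, e1, e2, e3, e4, e5]

lemma gaussBinom_one_right_sq_mul {q : ℕ} (hq : 2 ≤ q) (m : ℕ) :
    gaussBinom m 1 (q ^ 2) * ((q : ℚ) ^ 2 - 1) = (q : ℚ) ^ (2 * m) - 1 := by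
  have h1 := natCast_pow_sub_one_ne_zero hq two_ne_zero
  simp only [gaussBinom, Finset.prod_range_one, Nat.sub_zero, zero_add, pow_one]
  push_cast
  rw [div_mul_cancel₀ _ h1, pow_mul]

lemma pow_add_pow_le_gaussBinom {q : ℕ} (hq : 2 ≤ q) {m : ℕ} (hm : 2 ≤ m) :
    (q : ℚ) ^ (2 * m - 2) + (q : ℚ) ^ (2 * m - 4) ≤ gaussBinom m 1 (q ^ 2) := by
  obtain ⟨k, rfl⟩ := Nat.exists_eq_add_of_le hm
  have h := gaussBinom_one_right_sq_mul hq (2 + k)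
  have hq' : (2 : ℚ) ≤ q := by exact_mod_cast hq
  have h1 : (0 : ℚ) < (q : ℚ) ^ 2 - 1 := by nlinarith
  have e1 : 2 * (2 + k) - 2 = 2 * k + 2 := by omega
  have e2 : 2 * (2 + k) - 4 = 2 * k := by omega
  have h2 : (1 : ℚ) ≤ (q : ℚ) ^ (2 * k) := one_le_pow₀ (by linarith)
  refine le_of_mul_le_mul_right ?_ h1
  rw [h, e1, e2, show 2 * (2 + k) = 2 * k + 4 by ring, pow_add, pow_add]
  nlinarith

lemma one_le_pow_add_balancedCount {q m : ℕ} (hq : 2 ≤ q) (hm : 2 ≤ m) :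
    1 ≤ (q : ℚ) ^ (2 * m * (2 * m - 1)) + balancedCount (2 * m) q := by
  have hq' : (2 : ℚ) ≤ q := by exact_mod_cast hq
  have hq1 : (1 : ℚ) ≤ q := by linarith
  have e : (2 * m - 1) * (2 * m - 1 + 1) / 2 = m * (2 * m - 1) := by
    rw [show (2 * m - 1) * (2 * m - 1 + 1) = m * (2 * m - 1) * 2 by
      rw [show 2 * m - 1 + 1 = 2 * m by omega]; ring]
    exact Nat.mul_div_cancel _ two_pos
  rw [balancedCount_two_mul (by omega)]
  set N := m * (2 * m - 1) with hN
  have h1 := pow_le_prod_Icc_pow_add_one (x := (q : ℚ)) (by linarith) (2 * m - 1)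
  rw [e] at h1
  have h2 : 0 ≤ (q : ℚ) ^ (m * (m - 1)) * ∏ i ∈ Finset.range m, ((q : ℚ) ^ (2 * i + 1) - 1) :=
    mul_nonneg (by positivity) (prod_range_pow_odd_sub_one_nonneg hq1 m)
  have h3 : (q : ℚ) * ∑ r ∈ Finset.Icc 1 (m - 1), gaussBinom m r (q ^ 2) ≤ (q : ℚ) ^ N := by
    have h4 : ∀ r ∈ Finset.Icc 1 (m - 1), gaussBinom m r (q ^ 2) ≤
        (q : ℚ) ^ (2 * (m * (m - 1))) := fun r hr => by
      refine (gaussBinom_le_pow (two_le_sq hq) m r).trans ?_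
      rw [Nat.cast_pow, ← pow_mul]
      exact pow_le_pow_right₀ hq1
        (Nat.mul_le_mul_left _ (Nat.mul_le_mul_left _ (Finset.mem_Icc.1 hr).2))
    have h5 := Finset.sum_le_card_nsmul _ _ _ h4
    rw [Nat.card_Icc, Nat.add_sub_cancel, nsmul_eq_mul] at h5
    have h6 : ((m - 1 : ℕ) : ℚ) ≤ (q : ℚ) ^ (m - 1) := by
      exact_mod_cast (Nat.lt_pow_self (by omega : 1 < q)).le
    have h7 : (q : ℚ) ^ N = q * ((q : ℚ) ^ (m - 1) * (q : ℚ) ^ (2 * (m * (m - 1)))) := by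
      rw [← pow_add, ← pow_succ', hN]
      congr 1
      obtain ⟨k, rfl⟩ := Nat.exists_eq_add_of_le hm
      rw [show 2 * (2 + k) - 1 = 2 * k + 3 by omega, show 2 + k - 1 = k + 1 by omega]
      ring
    rw [h7]
    refine mul_le_mul_of_nonneg_left (h5.trans ?_) (by linarith)
    exact mul_le_mul_of_nonneg_right h6 (by positivity)
  have h8 : 1 ≤ gaussBinom m 1 (q ^ 2) := by
    refine le_trans ?_ (pow_add_pow_le_gaussBinom hq hm)
    have := one_le_pow₀ hq1 (n := 2 * m - 2)
    have : 0 ≤ (q : ℚ) ^ (2 * m - 4) := by positivity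
    linarith
  have h9 : 0 ≤ gaussBinom m 1 (q ^ 2) * (gaussBinom m 1 (q ^ 2) - 1) :=
    mul_nonneg (by linarith) (by linarith)
  have hN6 : 6 ≤ N := by
    have := Nat.mul_le_mul hm (by omega : 3 ≤ 2 * m - 1)
    omega
  have h10 : (q : ℚ) ^ (2 * m * (2 * m - 1)) = (q : ℚ) ^ N * (q : ℚ) ^ N := by
    rw [← pow_add, hN]
    congr 1
    ring
  have h11 : (q : ℚ) ^ 3 ≤ (q : ℚ) ^ N := pow_le_pow_right₀ hq1 (by omega)
  have h12 : (q : ℚ) + 3 ≤ (q : ℚ) ^ 3 := by nlinarith [sq_nonneg (q : ℚ)]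
  have h13 : (1 : ℚ) ≤ (q : ℚ) ^ N := one_le_pow₀ hq1
  rw [h10]
  nlinarith

lemma balancedCount_le {q m : ℕ} (hq : 2 ≤ q) (hm : 4 ≤ m) :
    balancedCount (2 * m) q ≤
      gaussBinom m 1 (q ^ 2) ^ 2 * (q : ℚ) ^ ((2 * m - 2) * (2 * m - 5)) := by
  have hq' : (2 : ℚ) ≤ q := by exact_mod_cast hq
  have hq1 : (1 : ℚ) ≤ q := by linarith
  have e : (2 * m - 1) * (2 * m - 1 + 1) / 2 = m * (2 * m - 1) := by
    rw [show (2 * m - 1) * (2 * m - 1 + 1) = m * (2 * m - 1) * 2 by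
      rw [show 2 * m - 1 + 1 = 2 * m by omega]; ring]
    exact Nat.mul_div_cancel _ two_pos
  have hσ := pow_add_pow_le_gaussBinom hq (by omega : 2 ≤ m)
  rw [balancedCount_two_mul (by omega)]
  set σ := gaussBinom m 1 (q ^ 2)
  have h1 := prod_Icc_pow_add_one_le hq' (by omega : 2 ≤ 2 * m - 1)
  rw [e] at h1
  have h2 : (q : ℚ) ^ (m * (m - 1)) * ∏ i ∈ Finset.range m, ((q : ℚ) ^ (2 * i + 1) - 1) ≤
      (q : ℚ) ^ (m * (2 * m - 1)) := by
    refine (mul_le_mul_of_nonneg_left (prod_range_pow_odd_sub_one_le hq1 m)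
      (by positivity)).trans (le_of_eq ?_)
    rw [← pow_add, ← mul_add]
    congr 2
    omega
  have h3 : 0 ≤ (q : ℚ) * ∑ r ∈ Finset.Icc 1 (m - 1), gaussBinom m r (q ^ 2) :=
    mul_nonneg (by linarith) (Finset.sum_nonneg fun r _ => gaussBinom_nonneg (two_le_sq hq) m r)
  obtain ⟨k, rfl⟩ := Nat.exists_eq_add_of_le hm
  have e1 : 2 * (4 + k) - 2 = 2 * k + 6 := by omega
  have e2 : 2 * (4 + k) - 4 = 2 * k + 4 := by omega
  have e3 : 2 * (4 + k) - 5 = 2 * k + 3 := by omega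
  have e4 : 2 * (4 + k) - 1 = 2 * k + 7 := by omega
  rw [e1, e2] at hσ
  rw [e1, e3]
  rw [e4] at h1 h2 ⊢
  set a := (q : ℚ) ^ (2 * k + 4) with ha
  set x := (q : ℚ) with hx
  have ha1 : 1 ≤ a := one_le_pow₀ hq1
  have h4 : 3 * x ^ (4 * k + 11) ≤ σ ^ 2 := by
    have h5 : (a * (x ^ 2 + 1)) ^ 2 ≤ σ ^ 2 := by
      refine pow_le_pow_left₀ (by positivity) (le_of_eq_of_le ?_ hσ) 2
      rw [ha, show 2 * k + 6 = 2 * k + 4 + 2 by ring, pow_add x (2 * k + 4) 2]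
      ring
    refine le_trans ?_ h5
    rw [show 4 * k + 11 = (2 * k + 4) + (2 * k + 4) + 3 by ring, pow_add, pow_add, ← ha]
    have h6 : 3 * x ^ 3 ≤ (x ^ 2 + 1) ^ 2 := by
      have := mul_nonneg (mul_nonneg (sq_nonneg x) (by linarith : 0 ≤ x - 1))
        (by linarith : 0 ≤ x - 2)
      nlinarith
    have h7 := mul_le_mul_of_nonneg_left h6 (by positivity : 0 ≤ a * a)
    linarith
  have h5 : (8 : ℚ) ≤ x ^ ((2 * k + 6) * (2 * k + 3)) := by
    have h6 : x ^ 3 ≤ x ^ ((2 * k + 6) * (2 * k + 3)) := pow_le_pow_right₀ hq1 (by nlinarith)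
    have h7 : (2 : ℚ) ^ 3 ≤ x ^ 3 := pow_le_pow_left₀ (by norm_num) hq' 3
    norm_num at h7
    linarith
  have h6 : x ^ ((4 + k) * (2 * k + 7)) * x ≤
      x ^ (4 * k + 11) * x ^ ((2 * k + 6) * (2 * k + 3)) := by
    rw [← pow_succ, ← pow_add]
    exact pow_le_pow_right₀ hq1 (by nlinarith)
  have h7 : ∏ i ∈ Finset.Icc 1 (2 * k + 7), (x ^ i + 1) ≤ 5 / 2 * x ^ ((4 + k) * (2 * k + 7)) := by
    refine h1.trans ?_
    have h8 : 0 ≤ (1 / 2 : ℚ) ^ (2 * k + 7) * x ^ ((4 + k) * (2 * k + 7)) := by positivity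
    linarith
  have hσ0 : 0 ≤ σ := le_trans (by positivity) hσ
  set E := x ^ ((2 * k + 6) * (2 * k + 3))
  set Y := x ^ ((4 + k) * (2 * k + 7))
  set P := ∏ i ∈ Finset.Icc 1 (2 * k + 7), (x ^ i + 1)
  set Q := x ^ ((4 + k) * (4 + k - 1)) * ∏ i ∈ Finset.range (4 + k), (x ^ (2 * i + 1) - 1)
  have hY : 0 ≤ Y := by positivity
  have h9 : (x + 1) * (P + Q) - 2 * (x + 1) * Y ≤ 9 / 4 * (Y * x) := by
    have := mul_le_mul_of_nonneg_left (add_le_add h7 h2) (by linarith : 0 ≤ x + 1)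
    nlinarith
  have h10 : 9 / 4 * (Y * x) ≤ σ ^ 2 * (E - 1) := by
    have h11 := mul_le_mul_of_nonneg_right h4 (by linarith : 0 ≤ E - 1)
    have h12 : 0 ≤ x ^ (4 * k + 11) := by positivity
    nlinarith
  linarith

/-! ### Assembling the code -/

/-- The balanced codes constructed above supply the required number of subspaces, for a space that
is at the same time a vector space of dimension `m` over the quadratic extension `K`. -/
theorem exists_isBalancedCode_balancedCount_le {F K S : Type*} [Field F] [Finite F] [Field K]
    [Algebra F K] [AddCommGroup S] [Module F S] [Module K S] [IsScalarTower F K S]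
    [FiniteDimensional F K] [FiniteDimensional F S] (hK : finrank F K = 2) {m : ℕ} (hm : 2 ≤ m)
    (hS : finrank K S = m) :
    ∃ D : Finset (Submodule F (S × S)), IsBalancedCode (2 * m) D ∧
      balancedCount (2 * m) (Nat.card F) ≤ D.card := by
  have hq := two_le_natCard_field F
  have hFS : finrank F S = 2 * m := by rw [← Module.finrank_mul_finrank F K S, hK, hS]
  rcases eq_or_lt_of_le hm with rfl | hm3
  · obtain ⟨D, hD, hcard⟩ := exists_isBalancedCode_of_quadratic_extension hK hS
    refine ⟨D, hD, le_of_eq ?_⟩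
    rw [hcard, balancedCount_four hq]
    push_cast
    ring
  · have : Finite K := Module.finite_of_finite F
    have : FiniteDimensional K S := FiniteDimensional.of_finrank_pos (by omega)
    have := finite_submodule K S
    have hKc : Nat.card K = Nat.card F ^ 2 := by
      rw [Module.natCard_eq_pow_finrank (K := F) (V := K), hK]
    have hΛ := natCard_submodule_finrank_eq (F := K) (V := S) 1
    rw [hS, hKc] at hΛ
    have hZ : finrank F (Fin (2 * m - 2) → F) = 2 * m - 2 := by
      rw [Module.finrank_pi, Fintype.card_fin]
    obtain ⟨L, hL⟩ := exists_isMRDCode (F := F) (E₁ := Fin (2 * m - 2) → F)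
      (E₂ := Fin (2 * m - 2) → F) rfl (by omega)
    obtain ⟨D, hD, hcard⟩ := exists_isBalancedCode_of_partialSpread (n := 2 * m) (by omega) hFS hZ
      (fun l : {l : Submodule K S // finrank K l = 1} => l.1.restrictScalars F)
      (fun l => (finrank_restrictScalars l.1).trans (by rw [hK, l.2]))
      (fun l l' h => restrictScalars_inf_eq_bot l.2 l'.2 fun h' => h (Subtype.ext h')) hL
    refine ⟨D, hD, ?_⟩
    rw [hcard, Nat.cast_mul, Nat.cast_pow, hΛ]
    have hσ := sq_nonneg (gaussBinom m 1 (Nat.card F ^ 2))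
    rcases eq_or_ne m 3 with rfl | hm4
    · refine (balancedCount_six_le hq).trans (mul_le_mul_of_nonneg_left ?_ hσ)
      have h := hL.natCard_finrank_range_le 2
      rw [hZ] at h
      refine le_of_le_of_eq ?_ h.symm
      simp [mrdRangeCount, gaussBinom_self hq]
    · refine (balancedCount_le hq (by omega)).trans (mul_le_mul_of_nonneg_left ?_ hσ)
      -- for `m ≥ 4` the codewords with range in one fixed subspace are numerous enough
      obtain ⟨X, hX⟩ := exists_submodule_finrank_eq (F := F) (V := Fin (2 * m - 2) → F)
        (r := 2 * m - 4) (by omega)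
      have hX0 : X ≠ ⊥ := fun h => by rw [h, finrank_bot] at hX; omega
      have h := hL X hX0
      rw [hZ, hX, show 2 * m - 4 - 1 = 2 * m - 5 by omega] at h
      have := finite_linearMap F (Fin (2 * m - 2) → F) (Fin (2 * m - 2) → F)
      rw [← Nat.cast_pow, ← h, Nat.cast_le]
      refine Nat.card_le_card_of_injective
        (fun φ => ⟨φ.1, φ.2.1, (Submodule.finrank_mono φ.2.2).trans hX.le⟩) fun φ ψ h => ?_
      exact Subtype.ext (congr_arg (fun x => x.1) h)

theorem theorem3p3 (n q : ℕ) (hn : 4 ≤ n) (hn_even : Even n) (hq : IsPrimePow q)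
    {F V : Type*} [Field F] [AddCommGroup V] [Module F V]
    (hF : Nat.card F = q) (hV : finrank F V = 2 * n) :
    ∃ M : ℕ,
      (M : ℚ) =
        (q : ℚ) ^ (n ^ 2 - n) - 2 * ((q : ℚ) + 1) * (q : ℚ) ^ (n * (n - 1) / 2)
        + ∑ r ∈ Finset.Icc 2 (n - 2), gaussBinom n r q *
            ∑ j ∈ Finset.Icc 2 r,
              (-1 : ℚ) ^ (r - j) * gaussBinom r j q * (q : ℚ) ^ (Nat.choose (r - j) 2)
                * ((q : ℚ) ^ (n * (j - 1)) - 1)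
        + ((q : ℚ) + 1) *
            (∏ i ∈ Finset.Icc 1 (n - 1), ((q : ℚ) ^ i + 1)
              + (q : ℚ) ^ (n * (n - 2) / 4)
                * ∏ i ∈ Finset.Icc 0 ((n - 2) / 2), ((q : ℚ) ^ (2 * i + 1) - 1))
        - (q : ℚ) * ∑ r ∈ Finset.Icc 1 ((n - 2) / 2), gaussBinom (n / 2) r (q ^ 2)
        + gaussBinom (n / 2) 1 (q ^ 2) * (gaussBinom (n / 2) 1 (q ^ 2) - 1)
        + 1 ∧
      ∃ C : Finset (Submodule F V), IsConstantDimensionCode (2 * n) M 4 n q C := by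
  have hq2 : 2 ≤ q := hq.two_le
  have : Finite F := Nat.finite_of_card_ne_zero (by omega)
  have : FiniteDimensional F V := FiniteDimensional.of_finrank_pos (by omega)
  obtain ⟨m, rfl⟩ := hn_even.two_dvd
  obtain ⟨K, _, _, hK⟩ := exists_field_extension F 2 two_ne_zero
  have : FiniteDimensional F K := FiniteDimensional.of_finrank_pos (by omega)
  have hS : finrank K (Fin m → K) = m := by rw [Module.finrank_pi, Fintype.card_fin]
  have hFS : finrank F (Fin m → K) = 2 * m := by
    rw [← Module.finrank_mul_finrank F K (Fin m → K), hK, hS]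
  obtain ⟨D, hD, hDcard⟩ :=
    exists_isBalancedCode_balancedCount_le (F := F) hK (by omega : 2 ≤ m) hS
  obtain ⟨C, hC1, hC2, hC3, hCcard⟩ := hD.exists_extension (by omega) hFS
  obtain ⟨L, hL⟩ := exists_isMRDCode (F := F) (E₁ := Fin m → K) (E₂ := Fin m → K) rfl (by omega)
  have hrank := hL.natCard_finrank_range_le (2 * m - 2)
  rw [hFS, hF] at hrank
  rw [hF] at hDcard hCcard
  obtain ⟨z, hz⟩ := exists_intCast_eq_balancedCount hq2 (2 * m)
  have hlow := one_le_pow_add_balancedCount hq2 (by omega : 2 ≤ m)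
  set R := Nat.card {φ : (Fin m → K) →ₗ[F] (Fin m → K) //
    φ ∈ L ∧ finrank F (LinearMap.range φ) ≤ 2 * m - 2} with hR
  have hR1 : 1 ≤ R := by
    have := finite_linearMap F (Fin m → K) (Fin m → K)
    refine Nat.one_le_iff_ne_zero.2 (Nat.card_ne_zero.2 ⟨⟨0, L.zero_mem, ?_⟩, inferInstance⟩)
    rw [LinearMap.range_zero, finrank_bot]
    exact Nat.zero_le _
  rw [← hrank] at hCcard
  rw [← hz] at hDcard hlow
  have hlow' : 1 ≤ (q : ℤ) ^ (2 * m * (2 * m - 1)) + z := by exact_mod_cast hlow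
  have hDcard' : z ≤ D.card := by exact_mod_cast hDcard
  have hCcard' : (C.card : ℤ) = (q : ℤ) ^ (2 * m * (2 * m - 1)) + R + D.card := by
    exact_mod_cast hCcard
  obtain ⟨M, hM⟩ := Int.eq_ofNat_of_zero_le
    (by omega : 0 ≤ (q : ℤ) ^ (2 * m * (2 * m - 1)) + R + z)
  refine ⟨M, ?_, exists_isConstantDimensionCode_of_le_card
    (LinearEquiv.ofFinrankEq _ _ (by rw [Module.finrank_prod, hFS, hV]; omega)) hF hV C hC1 hC2 hC3
    (by omega) (by omega)⟩
  have hM' : (M : ℚ) = (q : ℚ) ^ (2 * m * (2 * m - 1)) + R + z := by exact_mod_cast hM.symm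
  rw [hM', hrank, hz, balancedCount, show (2 * m) ^ 2 - 2 * m = 2 * m * (2 * m - 1) by
    rw [Nat.mul_sub, mul_one, sq]]
  simp only [mrdRangeCount]
  ring
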